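/- Let $k$ be an algebraically closed field of characteristic zero and let $m\ge 1$. Let $S_{m,m}\subset\mathbb{P}^{2m+1}$ be the rational normal scroll, i.e. the Zariski closure of the image of $(s,t)\mapsto(1:s:s^2:\ldots:s^m:t:st:s^2t:\ldots:s^mt)$, and let $X\subset\mathbb{P}^{2m+1}$ be projectively isomorphic to $S_{m,m}$. Let $L(X)\subset\mathfrak{sl}_{2m+2}$ be the tangent space at the identity of the group of all projective transformations of $\mathbb{P}^{2m+1}$ that map $X$ to itself, with its natural Lie product, and let $LSA(X)$ be a Levi subalgebra of $L(X)$. Let $\sigma$ be an isomorphism of $\mathfrak{sl}_2$ onto a direct summand (ideal) of $LSA(X)$, and let $\mathrm{Rep}\colon\mathfrak{sl}_2\to\mathfrak{gl}(k^{2m+2})$ be the induced representation on the linear forms in the homogeneous coordinates of $\mathbb{P}^{2m+1}$, where a form is identified with its vector of coefficients; thus $\mathrm{Rep}(a)u=-\sigma(a)^{T}u$. Suppose that $\mathrm{Rep}$ is isomorphic to $\mathrm{Sym}^m(k^2)\oplus\mathrm{Sym}^m(k^2)$. With $h=\begin{pmatrix}1&0\\0&-1\end{pmatrix}$ and $y=\begin{pmatrix}0&0\\1&0\end{pmatrix}$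 in $\mathfrak{sl}_2$, let $v$ be an eigenvector of $\mathrm{Rep}(h)$ with eigenvalue $m$, and let $w=\mathrm{Rep}(y)\cdot v$. Then the quotient $w/v$ of linear forms defines a morphism $\varphi\colon X\to\mathbb{P}^1$ whose fibres are the lines of $X$. Precisely: the set of the points of $X$ at which $v$ does not vanish is Zariski dense in $X$; there is a morphism $\varphi\colon X\to\mathbb{P}^1$ with $\varphi(p)=(v(p):w(p))$ for every $p\in X$ at which $v$ and $w$ do not both vanish; for every $c\in\mathbb{P}^1$ the fibre $\varphi^{-1}(c)$ is a line; and, if $m\ge 2$, every line contained in $X$ is one of these fibres. (If $m=1$, then $X$ is a smooth quadric surface with two rulings, and the fibres are the lines of one of them.) -/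

import Mathlib

open MvPolynomial Matrix
open scoped LinearAlgebra.Projectivization Pointwise

attribute [local instance 100] LieRing.ofAssociativeRing

noncomputable section

namespace LineFibration

/-! ### Projective geometry -/

section ProjectiveGeometry

variable {k : Type*} [Field k] {ι κ : Type*}

/-- The Zariski closure of a set `S` of points of the projective space with homogeneous coordinates
indexed by `ι`: the common zeros of all the forms that vanish on `S`. (The vanishing of a form at a
point does not depend on the representative.) -/
def zariskiClosure (S : Set (ℙ k (ι → k))) : Set (ℙ k (ι → k)) :=
  {p | ∀ (d : ℕ) (F : MvPolynomial ι k), F.IsHomogeneous d →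
    (∀ q ∈ S, eval q.rep F = 0) → eval p.rep F = 0}

/-- The vector `(1, s, s², …, s^m, t, s t, s² t, …, s^n t)`. -/
def scrollVector (m n : ℕ) (s t : k) : Fin (m + 1) ⊕ Fin (n + 1) → k :=
  Sum.elim (fun i => s ^ (i : ℕ)) (fun j => s ^ (j : ℕ) * t)

theorem scrollVector_ne_zero (m n : ℕ) (s t : k) : scrollVector m n s t ≠ 0 := fun h => by
  simpa [scrollVector] using congrFun h (Sum.inl 0)

/-- The rational normal scroll `S_{m,n}` in `P^{m+n+1}`, whose homogeneous coordinates
`x_{0,0}, …, x_{0,m}, x_{1,0}, …, x_{1,n}` are indexed by `Fin (m + 1) ⊕ Fin (n + 1)`. -/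
def scroll (k : Type*) [Field k] (m n : ℕ) : Set (ℙ k (Fin (m + 1) ⊕ Fin (n + 1) → k)) :=
  zariskiClosure (Set.range fun st : k × k =>
    Projectivization.mk k (scrollVector m n st.1 st.2) (scrollVector_ne_zero m n st.1 st.2))

/-- Two subsets of projective spaces are projectively isomorphic if an invertible linear change of
the homogeneous coordinates carries the one onto the other. -/
def ProjectivelyIsomorphic (X : Set (ℙ k (ι → k))) (Y : Set (ℙ k (κ → k))) : Prop :=
  ∃ g : (ι → k) ≃ₗ[k] (κ → k), Projectivization.map g.toLinearMap g.injective '' X = Y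

/-- A line of a projective space: the points contained in a `2`-dimensional linear subspace. -/
def IsLine (l : Set (ℙ k (ι → k))) : Prop :=
  ∃ W : Submodule k (ι → k), Module.finrank k W = 2 ∧ l = {p | p.submodule ≤ W}

/-- Morphisms from a (locally closed) subset `X` of a projective space to a projective space: in a
neighbourhood of every point of `X` the map is given by forms of one and the same degree without
common zeros. The neighbourhood of `p` is the set of all `q` in `X` at which the forms `F i`
do not all vanish. -/
def IsMorphism {X : Set (ℙ k (ι → k))} (φ : X → ℙ k (κ → k)) : Prop :=
  ∀ p : X, ∃ (d : ℕ) (F : κ → MvPolynomial ι k), (∀ i, (F i).IsHomogeneous d) ∧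
    (fun i => eval p.1.rep (F i)) ≠ 0 ∧
    ∀ (q : X) (hq : (fun i => eval q.1.rep (F i)) ≠ 0),
      φ q = Projectivization.mk k (fun i => eval q.1.rep (F i)) hq

/-- The morphism `φ : X → P¹` is the one defined by the quotient `w / v` of two linear forms, given
by their coefficient vectors: the quotient makes sense on a dense subset of `X`, and `φ` sends `p`
to `(v(p) : w(p))`, the point `w(p) / v(p)` of `P¹ = k ∪ {∞}`, wherever `v(p)` and `w(p)`
are not both zero. -/
def IsDefinedByQuotient [Fintype ι] {X : Set (ℙ k (ι → k))} (φ : X → ℙ k (Fin 2 → k))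
    (w v : ι → k) : Prop :=
  IsMorphism φ ∧ X ⊆ zariskiClosure {p ∈ X | v ⬝ᵥ p.rep ≠ 0} ∧
    ∀ (p : X) (hp : ![v ⬝ᵥ p.1.rep, w ⬝ᵥ p.1.rep] ≠ 0),
      φ p = Projectivization.mk k ![v ⬝ᵥ p.1.rep, w ⬝ᵥ p.1.rep] hp

/-- The fibre of `φ : X → P¹` over `c`, as a subset of the projective space that contains `X`. -/
def fibre {X : Set (ℙ k (ι → k))} (φ : X → ℙ k (Fin 2 → k)) (c : ℙ k (Fin 2 → k)) :
    Set (ℙ k (ι → k)) :=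
  Subtype.val '' (φ ⁻¹' {c})

end ProjectiveGeometry

/-! ### The Lie algebra of a projective variety -/

section LieAlgebraOfVariety

variable {k : Type*} [Field k] {ι : Type*} [Fintype ι] [DecidableEq ι]

/-- The group of all invertible matrices whose projective transformation maps `X` onto itself: the
preimage in `GL` of the group `PGL(X)`. -/
def projStabilizer (X : Set (ℙ k (ι → k))) : Subgroup (GL ι k) :=
  (MulAction.stabilizer (LinearMap.GeneralLinearGroup k (ι → k)) X).comap
    (Matrix.GeneralLinearGroup.toLin (n := ι) (R := k)).toMonoidHom

/-- The differential at the matrix `A` of the polynomial function `F` of the matrix entries, in the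
direction `M`. -/
def matDeriv (F : MvPolynomial (ι × ι) k) (A M : Matrix ι ι k) : k :=
  ∑ ij : ι × ι, M ij.1 ij.2 * eval (fun ij => A ij.1 ij.2) (pderiv ij F)

/-- `M` lies in the (Zariski) tangent space at the identity of the group `G` of invertible matrices:
the differential at the identity of every polynomial in the matrix entries that vanishes on `G`
is zero in the direction `M`. -/
def IsTangentAtOne (G : Subgroup (GL ι k)) (M : Matrix ι ι k) : Prop :=
  ∀ F : MvPolynomial (ι × ι) k,
    (∀ g ∈ G, eval (fun ij => (g : Matrix ι ι k) ij.1 ij.2) F = 0) → matDeriv F 1 M = 0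

theorem aeval_dual (F : MvPolynomial (ι × ι) k) (A M : Matrix ι ι k) :
    aeval (fun ij : ι × ι => (TrivSqZeroExt.inl (A ij.1 ij.2) + TrivSqZeroExt.inr (M ij.1 ij.2) :
      DualNumber k)) F =
      TrivSqZeroExt.inl (eval (fun ij => A ij.1 ij.2) F) + TrivSqZeroExt.inr (matDeriv F A M) := by
  induction F using MvPolynomial.induction_on with
  | C a => simp [matDeriv, TrivSqZeroExt.algebraMap_eq_inl]
  | add p q hp hq =>
    rw [map_add, hp, hq]
    ext <;> simp [matDeriv, mul_add, Finset.sum_add_distrib]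
  | mul_X p ij hp =>
    rw [map_mul, hp]
    have h : matDeriv (p * X ij) A M =
        eval (fun ij => A ij.1 ij.2) p * M ij.1 ij.2 + matDeriv p A M * A ij.1 ij.2 := by
      simp only [matDeriv, Derivation.leibniz, pderiv_X, smul_eq_mul, map_add, map_mul, eval_X,
        mul_add, Finset.sum_add_distrib, Finset.sum_mul]
      congr 1
      · rw [Finset.sum_eq_single ij]
        · simp [mul_comm]
        · intro b _ hb
          simp [hb.symm]
        · simp
      · exact Finset.sum_congr rfl fun x _ => by ring
    rw [h]
    ext <;> simp [mul_comm, add_comm]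

theorem matDeriv_eq_snd (F : MvPolynomial (ι × ι) k) (A M : Matrix ι ι k) :
    matDeriv F A M = (aeval (fun ij : ι × ι => (TrivSqZeroExt.inl (A ij.1 ij.2) +
      TrivSqZeroExt.inr (M ij.1 ij.2) : DualNumber k)) F).snd := by
  rw [aeval_dual]; simp

theorem IsTangentAtOne.conj {G : Subgroup (GL ι k)} {M : Matrix ι ι k} (hM : IsTangentAtOne G M)
    {g : GL ι k} (hg : g ∈ G) :
    IsTangentAtOne G ((g : Matrix ι ι k) * M * ((g⁻¹ : GL ι k) : Matrix ι ι k)) := by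
  intro F hF
  set a : Matrix ι ι k := (g : Matrix ι ι k) with ha
  set b : Matrix ι ι k := ((g⁻¹ : GL ι k) : Matrix ι ι k) with hb
  have hab : a * b = 1 := by rw [ha, hb]; exact Units.mul_inv g
  set P : ι × ι → MvPolynomial (ι × ι) k := fun ij =>
    ∑ q, (∑ p, C (a ij.1 p) * X (p, q)) * C (b q ij.2) with hP
  have key := hM (aeval P F) (by
    intro g' hg'
    have := hF (g * g' * g⁻¹) (G.mul_mem (G.mul_mem hg hg') (G.inv_mem hg))
    rw [← this, ← coe_aeval_eq_eval, ← coe_aeval_eq_eval, RingHom.coe_coe, RingHom.coe_coe,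
      ← AlgHom.comp_apply, comp_aeval]
    congr 2
    funext ij
    simp [hP, Matrix.mul_apply, ha, hb])
  rw [matDeriv_eq_snd] at key ⊢
  rw [← key, ← AlgHom.comp_apply, comp_aeval]
  congr 3
  funext ij
  have h1 : (1 : Matrix ι ι k) ij.1 ij.2 =
      ∑ q, ∑ p, a ij.1 p * (1 : Matrix ι ι k) p q * b q ij.2 := by
    have h : (1 : Matrix ι ι k) = a * (1 : Matrix ι ι k) * b := by rw [mul_one, hab]
    conv_lhs => rw [h]
    rw [Matrix.mul_apply]
    simp only [Matrix.mul_apply, Finset.sum_mul]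
  simp only [hP, map_sum, map_mul, aeval_X, aeval_C, TrivSqZeroExt.algebraMap_eq_inl]
  ext
  · simpa [TrivSqZeroExt.fst_sum, Finset.sum_mul] using h1
  · simp [Matrix.mul_apply, TrivSqZeroExt.snd_sum, Finset.sum_mul]

theorem IsTangentAtOne.lie {G : Subgroup (GL ι k)} {N M : Matrix ι ι k}
    (hN : IsTangentAtOne G N) (hM : IsTangentAtOne G M) (hNt : N.trace = 0) :
    IsTangentAtOne G (N * M - M * N) := by
  intro F hF
  set Q : Matrix ι ι (MvPolynomial (ι × ι) k) :=
    Matrix.of (fun i j => X (i, j)) with hQ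
  set P : Matrix ι ι (MvPolynomial (ι × ι) k) := Q * M.map C * Q.adjugate with hP
  set c : ι × ι → k := fun ij => eval (fun ij => (1 : Matrix ι ι k) ij.1 ij.2) (pderiv ij F) with hc
  have key := hN (∑ ij : ι × ι, C (c ij) * P ij.1 ij.2) (by
    intro g hg
    have h := hM.conj hg F hF
    have h2 : ∀ ij : ι × ι, eval (fun ij => (g : Matrix ι ι k) ij.1 ij.2) (P ij.1 ij.2) =
        (g : Matrix ι ι k).det * ((g : Matrix ι ι k) * M * ((g⁻¹ : GL ι k) : Matrix ι ι k))
          ij.1 ij.2 := by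
      intro ij
      have e1 : (eval (fun ij : ι × ι => (g : Matrix ι ι k) ij.1 ij.2)).mapMatrix P =
          (g : Matrix ι ι k) * M * (g : Matrix ι ι k).adjugate := by
        have e0 : (eval (fun ij : ι × ι => (g : Matrix ι ι k) ij.1 ij.2)).mapMatrix Q = g := by
          ext i j; simp [hQ]
        have e00 : (eval (fun ij : ι × ι => (g : Matrix ι ι k) ij.1 ij.2)).mapMatrix (M.map C)
            = M := by
          ext i j; simp
        rw [hP, map_mul, map_mul, RingHom.map_adjugate, e0, e00]
      have e2 : (g : Matrix ι ι k).adjugate =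
          (g : Matrix ι ι k).det • ((g⁻¹ : GL ι k) : Matrix ι ι k) := by
        calc (g : Matrix ι ι k).adjugate
            = (g : Matrix ι ι k).adjugate * ((g : Matrix ι ι k) * ((g⁻¹ : GL ι k) : Matrix ι ι k)) := by
              rw [Units.mul_inv, mul_one]
          _ = _ := by rw [← mul_assoc, Matrix.adjugate_mul, smul_mul_assoc, one_mul]
      have := congrFun (congrFun e1 ij.1) ij.2
      rw [e2, Matrix.mul_smul] at this
      simpa using this
    simp only [map_sum, map_mul, eval_C, h2]
    rw [matDeriv] at h
    have : ∀ ij : ι × ι, c ij * ((g : Matrix ι ι k).det *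
        ((g : Matrix ι ι k) * M * ((g⁻¹ : GL ι k) : Matrix ι ι k)) ij.1 ij.2) =
        (g : Matrix ι ι k).det * (((g : Matrix ι ι k) * M * ((g⁻¹ : GL ι k) : Matrix ι ι k))
          ij.1 ij.2 * c ij) := fun ij => by ring
    rw [Finset.sum_congr rfl fun ij _ => this ij, ← Finset.mul_sum, h, mul_zero])
  rw [matDeriv_eq_snd, map_sum, TrivSqZeroExt.snd_sum] at key
  rw [matDeriv, ← key]
  set α : MvPolynomial (ι × ι) k →ₐ[k] DualNumber k := aeval (fun ij : ι × ι =>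
    (TrivSqZeroExt.inl ((1 : Matrix ι ι k) ij.1 ij.2) + TrivSqZeroExt.inr (N ij.1 ij.2) :
      DualNumber k)) with hα
  let inlM : Matrix ι ι k → Matrix ι ι (DualNumber k) := fun A => A.map TrivSqZeroExt.inl
  have hQα : α.toRingHom.mapMatrix Q = 1 + (DualNumber.eps : DualNumber k) • inlM N := by
    ext i j <;> by_cases hij : i = j <;> simp [hQ, hα, inlM, Matrix.one_apply, hij]
  have hMα : α.toRingHom.mapMatrix (M.map C) = inlM M := by
    ext i j <;> simp [inlM, TrivSqZeroExt.algebraMap_eq_inl]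
  have htr : (inlM N).trace = 0 := by
    have := congrArg (TrivSqZeroExt.inlHom k k) hNt
    simpa [Matrix.trace, inlM] using this
  have hdet : (1 + (DualNumber.eps : DualNumber k) • inlM N).det = 1 := by
    rw [Matrix.det_one_add_smul, htr, DualNumber.eps_pow_two]; simp
  have hinv : (1 + (DualNumber.eps : DualNumber k) • inlM N) *
      (1 - (DualNumber.eps : DualNumber k) • inlM N) = 1 := by
    rw [mul_sub, mul_one, add_mul, one_mul, smul_mul_smul_comm, DualNumber.eps_mul_eps, zero_smul]
    simp
  have hadj : (1 + (DualNumber.eps : DualNumber k) • inlM N).adjugate =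
      1 - (DualNumber.eps : DualNumber k) • inlM N := by
    calc _ = (1 + (DualNumber.eps : DualNumber k) • inlM N).adjugate *
          ((1 + (DualNumber.eps : DualNumber k) • inlM N) *
            (1 - (DualNumber.eps : DualNumber k) • inlM N)) := by rw [hinv, mul_one]
      _ = _ := by rw [← mul_assoc, Matrix.adjugate_mul, hdet, one_smul, one_mul]
  have hPα : α.toRingHom.mapMatrix P =
      inlM M + (DualNumber.eps : DualNumber k) • inlM (N * M - M * N) := by
    have hm : ∀ A B : Matrix ι ι k, inlM (A * B) = inlM A * inlM B := fun A B =>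
      map_mul (TrivSqZeroExt.inlHom k k).mapMatrix A B
    have hs : inlM (N * M - M * N) = inlM N * inlM M - inlM M * inlM N := by
      rw [← hm, ← hm]
      exact map_sub (TrivSqZeroExt.inlHom k k).mapMatrix _ _
    rw [hP, map_mul, map_mul, RingHom.map_adjugate, hQα, hMα, hadj, hs]
    simp only [add_mul, mul_sub, one_mul, mul_one, smul_mul_assoc, mul_smul_comm, smul_sub,
      smul_add, smul_smul, DualNumber.eps_mul_eps, zero_smul, add_zero]
    abel
  refine Finset.sum_congr rfl fun ij _ => ?_
  have h := congrFun (congrFun hPα ij.1) ij.2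
  have h' : α (P ij.1 ij.2) = TrivSqZeroExt.inl (M ij.1 ij.2) +
      DualNumber.eps * TrivSqZeroExt.inl ((N * M - M * N) ij.1 ij.2) := h
  rw [map_mul, h']
  have hC : α (C (c ij)) = TrivSqZeroExt.inl (c ij) := by
    rw [hα, aeval_C, TrivSqZeroExt.algebraMap_eq_inl]
  rw [hC]
  simp [hc, mul_comm]

/-- The Lie algebra `L(X)` of a projective variety `X`: the tangent space at the identity of the
group `PGL(X)` of all projective transformations that map `X` to itself. The tangent space of `PGL`
at the identity (all matrices modulo scalar matrices) is identified as usual, in characteristic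
zero, with the space of the matrices of trace zero; `L(X)` then consists of the trace zero matrices
that are tangent to the preimage of `PGL(X)` in `GL`. The Lie product is the commutator. -/
def lieAlgebraOf (X : Set (ℙ k (ι → k))) : LieSubalgebra k (Matrix ι ι k) where
  carrier := {M | M.trace = 0 ∧ IsTangentAtOne (projStabilizer X) M}
  add_mem' := by
    rintro M N ⟨hM, hM'⟩ ⟨hN, hN'⟩
    refine ⟨by simp [hM, hN], fun F hF => ?_⟩
    have h1 := hM' F hF
    have h2 := hN' F hF
    simp only [matDeriv, Matrix.add_apply, add_mul, Finset.sum_add_distrib] at h1 h2 ⊢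
    rw [h1, h2, add_zero]
  zero_mem' := ⟨by simp, fun F _ => by simp [matDeriv]⟩
  smul_mem' := by
    rintro c M ⟨hM, hM'⟩
    refine ⟨by simp [hM], fun F hF => ?_⟩
    have h1 := hM' F hF
    simp only [matDeriv, Matrix.smul_apply, smul_eq_mul, mul_assoc, ← Finset.mul_sum] at h1 ⊢
    rw [h1, mul_zero]
  lie_mem' := by
    rintro M N ⟨hM, hM'⟩ ⟨hN, hN'⟩
    exact ⟨by rw [Ring.lie_def, Matrix.trace_sub, Matrix.trace_mul_comm, sub_self],
      hM'.lie hN' hM⟩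

end LieAlgebraOfVariety

/-! ### Lie algebras and representations -/

section Representations

variable {k : Type*} [Field k]

/-- A Levi subalgebra of a Lie algebra `L`: a semisimple subalgebra that is a vector space
complement of the solvable radical of `L`. -/
def IsLeviSubalgebra {L : Type*} [LieRing L] [LieAlgebra k L] (S : LieSubalgebra k L) : Prop :=
  LieAlgebra.IsSemisimple k S ∧ IsCompl S.toSubmodule (LieAlgebra.radical k L).toSubmodule

/-- The Lie algebra `sl₂` of the `2 × 2` matrices of trace zero. -/
abbrev sl2 (k : Type*) [Field k] : LieSubalgebra k (Matrix (Fin 2) (Fin 2) k) :=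
  LieAlgebra.SpecialLinear.sl (Fin 2) k

/-- The element `h` of the Chevalley basis of `sl₂`. -/
def sl2H (k : Type*) [Field k] : sl2 k :=
  ⟨!![1, 0; 0, -1], LinearMap.mem_ker.2 (by simp [Matrix.trace_fin_two])⟩

/-- The element `y` of the Chevalley basis of `sl₂`. -/
def sl2Y (k : Type*) [Field k] : sl2 k :=
  ⟨!![0, 0; 1, 0], LinearMap.mem_ker.2 (by simp [Matrix.trace_fin_two])⟩

/-- The derivation of the polynomial ring `k[X₀, X₁]` that acts on the span of `X₀, X₁` as the
matrix `A` acts on the standard basis of `k²`. -/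
def symDerivation (A : Matrix (Fin 2) (Fin 2) k) :
    Derivation k (MvPolynomial (Fin 2) k) (MvPolynomial (Fin 2) k) :=
  mkDerivation k fun i => ∑ j, C (A j i) * X j

theorem symDerivation_apply (A : Matrix (Fin 2) (Fin 2) k) (P : MvPolynomial (Fin 2) k) :
    symDerivation A P = ∑ i, (∑ j, C (A j i) * X j) * pderiv i P := by
  have h : symDerivation A =
      ∑ i, (∑ j, C (A j i) * X j : MvPolynomial (Fin 2) k) • pderiv (R := k) i :=
    derivation_ext fun i => by
      fin_cases i <;> simp [symDerivation, mkDerivation_X, pderiv_X]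
  rw [h]
  simp

theorem symDerivation_mem (A : Matrix (Fin 2) (Fin 2) k) (n : ℕ) {P : MvPolynomial (Fin 2) k}
    (hP : P ∈ homogeneousSubmodule (Fin 2) k n) :
    symDerivation A P ∈ homogeneousSubmodule (Fin 2) k n := by
  rw [mem_homogeneousSubmodule] at hP
  cases n with
  | zero =>
    rw [totalDegree_eq_zero_iff_eq_C.1 (Nat.le_zero.1 hP.totalDegree_le), symDerivation_apply]
    simp
  | succ n =>
    rw [symDerivation_apply]
    refine Submodule.sum_mem _ fun i _ => ?_
    rw [mem_homogeneousSubmodule, add_comm]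
    refine IsHomogeneous.mul ?_ hP.pderiv
    exact IsHomogeneous.sum _ _ _ fun j _ => by
      simpa using (isHomogeneous_C _ (A j i)).mul (isHomogeneous_X k j)

/-- The representation of `sl₂` on `Sym^n(k²)`, the space of the homogeneous polynomials of degree
`n` in two variables, for `k²` the defining representation. -/
def symPower (k : Type*) [Field k] (n : ℕ) :
    sl2 k →ₗ⁅k⁆ Module.End k (homogeneousSubmodule (Fin 2) k n) where
  toFun A := (symDerivation (A : Matrix (Fin 2) (Fin 2) k)).toLinearMap.restrict
    fun _ hP => symDerivation_mem _ n hP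
  map_add' A B := by
    ext P : 2
    simp [symDerivation_apply, Finset.sum_add_distrib, add_mul]
  map_smul' c A := by
    ext P : 2
    simp [symDerivation_apply, smul_eq_C_mul]
    ring
  map_lie' := by
    intro A B
    have h : symDerivation (⁅A, B⁆ : sl2 k).1 = ⁅symDerivation A.1, symDerivation B.1⁆ :=
      derivation_ext fun i => by
        rw [LieAlgebra.SpecialLinear.sl_bracket, Derivation.commutator_apply]
        simp only [symDerivation, mkDerivation_X, Derivation.leibniz, derivation_C,
          Fin.sum_univ_two, Matrix.sub_apply, Matrix.mul_apply, smul_eq_mul, map_add, map_sub,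
          map_mul, mul_zero, add_zero]
        ring
    ext P : 2
    have hP := congrArg (fun D => D P.1) h
    simpa [Derivation.commutator_apply, Ring.lie_def] using hP

/-- The contragredient of the defining representation: the action of matrices on linear forms.
The matrix `M` sends the linear form `f` to the linear form `p ↦ -f (M p)`; on the vector `u` of
the coefficients of `f` this is `u ↦ -Mᵀ u`. -/
def linearFormRep (k : Type*) [Field k] (ι : Type*) [Fintype ι] [DecidableEq ι] :
    Matrix ι ι k →ₗ⁅k⁆ Module.End k (ι → k) where
  toFun M := -(Mᵀ).mulVecLin
  map_add' M N := by
    ext; simp [Matrix.mulVecLin_add, add_comm]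
  map_smul' c M := by
    ext; simp
  map_lie' := by
    intro M N
    refine LinearMap.ext fun u => ?_
    simp [Ring.lie_def, Matrix.sub_mulVec]

/-- The representation `Rep` of `sl₂` on the linear forms of the ambient space of `X` that is given
by an isomorphism `σ` of `sl₂` onto an ideal `I` of a subalgebra `S` of `L(X)`. (In a semisimple Lie
algebra, the direct summands are precisely the ideals.) -/
def summandRep {ι : Type*} [Fintype ι] [DecidableEq ι] {X : Set (ℙ k (ι → k))}
    {S : LieSubalgebra k (lieAlgebraOf X)} {I : LieIdeal k S} (σ : sl2 k ≃ₗ⁅k⁆ I) :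
    sl2 k →ₗ⁅k⁆ Module.End k (ι → k) :=
  (linearFormRep k ι).comp ((lieAlgebraOf X).incl.comp (S.incl.comp (I.incl.comp σ.toLieHom)))

/-- The representation `ρ` of `sl₂` is isomorphic to `Sym^n(k²) ⊕ Sym^n(k²)`. -/
def IsTwoCopiesOfSymPower {V : Type*} [AddCommGroup V] [Module k V]
    (ρ : sl2 k →ₗ⁅k⁆ Module.End k V) (n : ℕ) : Prop :=
  ∃ e : V ≃ₗ[k] homogeneousSubmodule (Fin 2) k n × homogeneousSubmodule (Fin 2) k n,
    ∀ (a : sl2 k) (u : V), e (ρ a u) = (symPower k n a (e u).1, symPower k n a (e u).2)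

end Representations

end LineFibration

end

/-!
The action of the Lie algebra determines the surface `X` in suitable coordinates, so that neither
`L(X)` nor its Levi subalgebras have to be computed.

Choose the homogeneous coordinates `x_{a,i}` of the ambient space that correspond to the weight
basis `m^i X₀^{m-i} X₁^i` of the two copies `a = 0, 1` of `Sym^m`
(`IsTwoCopiesOfSymPower.exists_basis`). The claim is that in these coordinates `X` is the scroll
`S_{m,m}` itself (`coneOf_eq_preimage_of_weight_basis`). A matrix tangent to the stabilizer of `X`
acts, as a derivation, on the space of the quadrics through `X`
(`IsTangentAtOne.bilinDerivation_mem`). Hence this space is stable under the vector fields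
`x_{a,i} ↦ i x_{a,i}` and `x_{a,i} ↦ i x_{a,i-1}`, which are, up to scalar matrices and scalar
factors, those of the elements `h` and `x` of `sl₂`. On the curves `s ↦ (s^i, s^i t)` of the scroll
they are `s d/ds` and `d/ds`. A quadric through `X` may be taken to be homogeneous for the weights
`i`, of weight `d` say. If `d > 0`, its restriction to the scroll is `s / d` times that of its
derivative, which is a quadric through `X` of weight `d - 1`; so it is enough to treat weight `0`.
A quadric of weight `0` is the product of two linear forms in `x_{0,0}` and `x_{1,0}`; if it
vanishes on `X`, it vanishes identically, because `X` is irreducible and lies in no hyperplane. So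
the quadrics through `X` all contain the scroll (`quadricsOn_le_quadricsOn_scrollCone`). As `X` is
projectively isomorphic to the scroll, the two spaces of quadrics have the same dimension, and they
are equal. Finally the scroll is cut out by quadrics, the minors of the `2 × 2m` matrix with
columns `(x_{a,i}, x_{a,i+1})` (`mem_scrollCone_iff_of_stable`).

In these coordinates `v = α x_{0,0} + β x_{1,0}` and `w = α x_{0,1} + β x_{1,1}`. At a point of the
scroll the columns of the matrix are all proportional to one vector `(c₀, c₁)`, so `w / v` is
`c₁ / c₀`, any nonzero column defines the same map locally, and the fibres are the lines of the
ruling (`isDefinedByQuotient_rulingMap`, `fibre_rulingMap`). For `m ≥ 2` there is no other line on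
the scroll (`mem_ruling_of_add_mem_scrollCone`).
-/

noncomputable section

namespace LineFibration

/-! ### The ruling of the cone over the scroll -/

section Ruling

variable {k : Type*} [Field k] {m : ℕ}

/-- The coordinates `x_{a,i}` with `i < m`: the first row of the `2 × 2m` matrix whose
minors define the scroll `S_{m,m}`. -/
def scrollLo : Fin m ⊕ Fin m → Fin (m + 1) ⊕ Fin (m + 1) := Sum.map Fin.castSucc Fin.castSucc

/-- The coordinates `x_{a,i+1}` with `i < m`: the second row of the `2 × 2m` matrix whose
minors define the scroll `S_{m,m}`. -/
def scrollHi : Fin m ⊕ Fin m → Fin (m + 1) ⊕ Fin (m + 1) := Sum.map Fin.succ Fin.succ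

/-- The linear subspace over the line of the scroll `S_{m,m}` with parameter `(c₀ : c₁)`: on it the
two rows of the defining `2 × 2m` matrix are in the ratio `c₀ : c₁`. -/
def ruling (m : ℕ) (c : Fin 2 → k) : Submodule k (Fin (m + 1) ⊕ Fin (m + 1) → k) where
  carrier := {x | ∀ j, c 1 * x (scrollLo j) = c 0 * x (scrollHi j)}
  add_mem' {x y} hx hy j := by simp only [Pi.add_apply, mul_add, hx j, hy j]
  zero_mem' j := by simp
  smul_mem' a x hx j := by simp only [Pi.smul_apply, smul_eq_mul, mul_left_comm _ a, hx j]

theorem mem_ruling {c : Fin 2 → k} {x : Fin (m + 1) ⊕ Fin (m + 1) → k} :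
    x ∈ ruling m c ↔ ∀ j, c 1 * x (scrollLo j) = c 0 * x (scrollHi j) := Iff.rfl

/-- The cone over the scroll `S_{m,m}`, described as the union of the planes over its lines. -/
def scrollCone (k : Type*) [Field k] (m : ℕ) : Set (Fin (m + 1) ⊕ Fin (m + 1) → k) :=
  {x | ∃ c : Fin 2 → k, c ≠ 0 ∧ x ∈ ruling m c}

theorem smul_mem_scrollCone {x : Fin (m + 1) ⊕ Fin (m + 1) → k} (hx : x ∈ scrollCone k m) (a : k) :
    a • x ∈ scrollCone k m := by
  obtain ⟨c, hc, h⟩ := hx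
  exact ⟨c, hc, Submodule.smul_mem _ a h⟩

/-- The parametrization `(t₀, t₁) ↦ (t_a c₀^{m-i} c₁^i)_{a,i}` of the plane `ruling m c`. -/
def rulingParam (m : ℕ) (c : Fin 2 → k) :
    (Fin 2 → k) →ₗ[k] (Fin (m + 1) ⊕ Fin (m + 1) → k) where
  toFun t := Sum.elim (fun i => t 0 * (c 0 ^ (m - (i : ℕ)) * c 1 ^ (i : ℕ)))
    (fun i => t 1 * (c 0 ^ (m - (i : ℕ)) * c 1 ^ (i : ℕ)))
  map_add' t u := by ext (i | i) <;> simp [add_mul]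
  map_smul' a t := by ext (i | i) <;> simp [mul_assoc]

theorem rulingParam_inl (c t : Fin 2 → k) (i : Fin (m + 1)) :
    rulingParam m c t (Sum.inl i) = t 0 * (c 0 ^ (m - (i : ℕ)) * c 1 ^ (i : ℕ)) := rfl

theorem rulingParam_inr (c t : Fin 2 → k) (i : Fin (m + 1)) :
    rulingParam m c t (Sum.inr i) = t 1 * (c 0 ^ (m - (i : ℕ)) * c 1 ^ (i : ℕ)) := rfl

theorem rulingParam_mem_ruling (c t : Fin 2 → k) : rulingParam m c t ∈ ruling m c := by
  have key : ∀ (i : Fin m) (b : k), c 1 * (b * (c 0 ^ (m - (i : ℕ)) * c 1 ^ (i : ℕ))) =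
      c 0 * (b * (c 0 ^ (m - ((i : ℕ) + 1)) * c 1 ^ ((i : ℕ) + 1))) := by
    intro i b
    have : m - (i : ℕ) = m - ((i : ℕ) + 1) + 1 := by omega
    rw [this]
    ring
  rintro (i | i)
  · exact key i (t 0)
  · exact key i (t 1)

theorem rulingParam_mem_scrollCone (c t : Fin 2 → k) : rulingParam m c t ∈ scrollCone k m := by
  by_cases hc : c = 0
  · subst hc
    -- For `c = 0` the second row vanishes, since its entries contain positive powers of `c₁`.
    refine ⟨![1, 0], fun h => one_ne_zero (congrFun h 0), ?_⟩
    rintro (i | i) <;> simp [scrollHi, rulingParam_inl, rulingParam_inr]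
  · exact ⟨c, hc, rulingParam_mem_ruling c t⟩

theorem exists_rulingParam_eq {c : Fin 2 → k} (hc : c ≠ 0) {x : Fin (m + 1) ⊕ Fin (m + 1) → k}
    (hx : x ∈ ruling m c) : ∃ t, rulingParam m c t = x := by
  by_cases h0 : c 0 = 0
  · have h1 : c 1 ≠ 0 := fun h1 => hc (by ext i; fin_cases i <;> simp [h0, h1])
    have hlo : ∀ j, x (scrollLo j) = 0 := fun j => by simpa [h0, h1] using hx j
    refine ⟨![x (Sum.inl (Fin.last m)) / c 1 ^ m, x (Sum.inr (Fin.last m)) / c 1 ^ m], ?_⟩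
    ext (i | i)
    · rw [rulingParam_inl]
      induction i using Fin.lastCases with
      | last => simp [h1]
      | cast i =>
        have : m - (i : ℕ) ≠ 0 := by omega
        simpa [h0, this, scrollLo] using (hlo (Sum.inl i)).symm
    · rw [rulingParam_inr]
      induction i using Fin.lastCases with
      | last => simp [h1]
      | cast i =>
        have : m - (i : ℕ) ≠ 0 := by omega
        simpa [h0, this, scrollLo] using (hlo (Sum.inr i)).symm
  · have key : ∀ f : Fin (m + 1) → k, (∀ i : Fin m, c 1 * f i.castSucc = c 0 * f i.succ) →
        ∀ i : Fin (m + 1), f 0 / c 0 ^ m * (c 0 ^ (m - (i : ℕ)) * c 1 ^ (i : ℕ)) = f i := by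
      intro f hf i
      induction i using Fin.induction with
      | zero => simp [h0]
      | succ i ih =>
        have : m - (i : ℕ) = m - ((i : ℕ) + 1) + 1 := by omega
        refine mul_left_cancel₀ h0 ?_
        rw [← hf i, ← ih]
        simp only [Fin.val_succ, Fin.val_castSucc]
        rw [this]
        ring
    refine ⟨![x (Sum.inl 0) / c 0 ^ m, x (Sum.inr 0) / c 0 ^ m], ?_⟩
    ext (i | i)
    · exact key (fun i => x (Sum.inl i)) (fun i => hx (Sum.inl i)) i
    · exact key (fun i => x (Sum.inr i)) (fun i => hx (Sum.inr i)) i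

theorem rulingParam_injective {c : Fin 2 → k} (hc : c ≠ 0) :
    Function.Injective (rulingParam m c) := by
  refine (injective_iff_map_eq_zero _).2 fun t ht => ?_
  by_cases h0 : c 0 = 0
  · have h1 : c 1 ≠ 0 := fun h1 => hc (by ext i; fin_cases i <;> simp [h0, h1])
    have e0 := congrFun ht (Sum.inl (Fin.last m))
    have e1 := congrFun ht (Sum.inr (Fin.last m))
    rw [rulingParam_inl] at e0
    rw [rulingParam_inr] at e1
    ext i
    fin_cases i
    · simpa [h1] using e0
    · simpa [h1] using e1
  · have e0 := congrFun ht (Sum.inl 0)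
    have e1 := congrFun ht (Sum.inr 0)
    rw [rulingParam_inl] at e0
    rw [rulingParam_inr] at e1
    ext i
    fin_cases i
    · simpa [h0] using e0
    · simpa [h0] using e1

theorem finrank_ruling {c : Fin 2 → k} (hc : c ≠ 0) : Module.finrank k (ruling m c) = 2 := by
  have h : LinearMap.range (rulingParam m c) = ruling m c := by
    refine le_antisymm ?_ fun x hx => exists_rulingParam_eq hc hx
    rintro _ ⟨t, rfl⟩
    exact rulingParam_mem_ruling c t
  rw [← h, LinearMap.finrank_range_of_inj (rulingParam_injective hc)]
  simp

theorem mem_scrollCone_iff_exists_rulingParam {x : Fin (m + 1) ⊕ Fin (m + 1) → k} :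
    x ∈ scrollCone k m ↔ ∃ c t, rulingParam m c t = x := by
  constructor
  · rintro ⟨c, hc, hx⟩
    exact ⟨c, exists_rulingParam_eq hc hx⟩
  · rintro ⟨c, t, rfl⟩
    exact rulingParam_mem_scrollCone c t

theorem eq_zero_of_mul_eq_mul {c c' : Fin 2 → k} (h : c 0 * c' 1 ≠ c 1 * c' 0) {a b : k}
    (h1 : c 1 * a = c 0 * b) (h2 : c' 1 * a = c' 0 * b) : a = 0 ∧ b = 0 := by
  have h' : c 0 * c' 1 - c 1 * c' 0 ≠ 0 := sub_ne_zero.2 h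
  constructor
  · refine (mul_eq_zero.1 (?_ : (c 0 * c' 1 - c 1 * c' 0) * a = 0)).resolve_left h'
    linear_combination c 0 * h2 - c' 0 * h1
  · refine (mul_eq_zero.1 (?_ : (c 0 * c' 1 - c 1 * c' 0) * b = 0)).resolve_left h'
    linear_combination c 1 * h2 - c' 1 * h1

/-- A vector is zero as soon as both rows of its `2 × 2m` matrix are, for `m ≥ 1`. -/
theorem exists_scrollLo_or_scrollHi_ne_zero (hm : 1 ≤ m) {x : Fin (m + 1) ⊕ Fin (m + 1) → k}
    (hx : x ≠ 0) : ∃ j, x (scrollLo j) ≠ 0 ∨ x (scrollHi j) ≠ 0 := by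
  by_contra! h
  refine hx ?_
  ext (i | i)
  · induction i using Fin.cases with
    | zero => exact (h (Sum.inl ⟨0, hm⟩)).1
    | succ i => exact (h (Sum.inl i)).2
  · induction i using Fin.cases with
    | zero => exact (h (Sum.inr ⟨0, hm⟩)).1
    | succ i => exact (h (Sum.inr i)).2

/-- The lines of the ruling are pairwise disjoint. -/
theorem mul_eq_mul_of_mem_ruling (hm : 1 ≤ m) {c c' : Fin 2 → k}
    {x : Fin (m + 1) ⊕ Fin (m + 1) → k} (hx : x ≠ 0) (h : x ∈ ruling m c) (h' : x ∈ ruling m c') :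
    c 0 * c' 1 = c 1 * c' 0 := by
  by_contra hcc
  obtain ⟨j, hj⟩ := exists_scrollLo_or_scrollHi_ne_zero hm hx
  have := eq_zero_of_mul_eq_mul hcc (h j) (h' j)
  exact hj.elim (fun e => e this.1) (fun e => e this.2)

theorem mk_eq_mk_of_mul_eq_mul {c c' : Fin 2 → k} (hc : c ≠ 0) (hc' : c' ≠ 0)
    (h : c 0 * c' 1 = c 1 * c' 0) : Projectivization.mk k c hc = Projectivization.mk k c' hc' := by
  rw [Projectivization.mk_eq_mk_iff']
  by_cases h0 : c' 0 = 0
  · have h1 : c' 1 ≠ 0 := fun h1 => hc' (by ext i; fin_cases i <;> simp [h0, h1])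
    have : c 0 = 0 := by simpa [h0, h1] using h
    refine ⟨c 1 / c' 1, ?_⟩
    ext i
    fin_cases i
    · simp [h0, this]
    · simp [h1]
  · refine ⟨c 0 / c' 0, ?_⟩
    ext i
    fin_cases i
    · simp [h0]
    · simp only [Pi.smul_apply, smul_eq_mul]
      field_simp
      exact h.trans (mul_comm _ _)

theorem ruling_smul (c : Fin 2 → k) {a : k} (ha : a ≠ 0) : ruling m (a • c) = ruling m c := by
  ext x
  simp only [mem_ruling, Pi.smul_apply, smul_eq_mul, mul_assoc, mul_right_inj' ha]

theorem ruling_rep_mk {c : Fin 2 → k} (hc : c ≠ 0) :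
    ruling m (Projectivization.mk k c hc).rep = ruling m c := by
  obtain ⟨a, ha⟩ := Projectivization.exists_smul_eq_mk_rep k c hc
  rw [← ha]
  exact ruling_smul c a.ne_zero

/-- The cone over the scroll is cut out by the `2 × 2` minors of the `2 × 2m` matrix. -/
theorem mem_scrollCone_of_minors {x : Fin (m + 1) ⊕ Fin (m + 1) → k}
    (h : ∀ i j, x (scrollLo i) * x (scrollHi j) = x (scrollHi i) * x (scrollLo j)) :
    x ∈ scrollCone k m := by
  by_cases hx : ∃ i : Fin m ⊕ Fin m, ![x (scrollLo i), x (scrollHi i)] ≠ 0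
  · obtain ⟨i, hi⟩ := hx
    exact ⟨_, hi, fun j => by simpa using (h i j).symm⟩
  · push Not at hx
    refine ⟨![1, 0], fun h => one_ne_zero (congrFun h 0), fun j => ?_⟩
    have : x (scrollHi j) = 0 := congrFun (hx j) 1
    simp [this]

theorem minors_of_mem_scrollCone {x : Fin (m + 1) ⊕ Fin (m + 1) → k} (hx : x ∈ scrollCone k m)
    (i j : Fin m ⊕ Fin m) :
    x (scrollLo i) * x (scrollHi j) = x (scrollHi i) * x (scrollLo j) := by
  obtain ⟨c, hc, h⟩ := hx
  by_cases h0 : c 0 = 0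
  · have h1 : c 1 ≠ 0 := fun h1 => hc (by ext i; fin_cases i <;> simp [h0, h1])
    have hlo : ∀ j, x (scrollLo j) = 0 := fun j => by simpa [h0, h1] using h j
    simp [hlo]
  · refine mul_left_cancel₀ h0 ?_
    linear_combination x (scrollLo j) * h i - x (scrollLo i) * h j

theorem scrollVector_mem_scrollCone (s t : k) : scrollVector m m s t ∈ scrollCone k m := by
  rw [mem_scrollCone_iff_exists_rulingParam]
  refine ⟨![1, s], ![1, t], ?_⟩
  ext (i | i)
  · simp [rulingParam_inl, scrollVector]
  · simp [rulingParam_inr, scrollVector, mul_comm]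

/-- A vector of the cone with `x_{0,0} ≠ 0` is a multiple of a vector
`(1, s, …, s^m, t, s t, …, s^m t)`. -/
theorem eq_smul_scrollVector {x : Fin (m + 1) ⊕ Fin (m + 1) → k} (hx : x ∈ scrollCone k m)
    (h0 : x (Sum.inl 0) ≠ 0) : ∃ a s t : k, x = a • scrollVector m m s t := by
  obtain ⟨c, t, rfl⟩ := mem_scrollCone_iff_exists_rulingParam.1 hx
  rw [rulingParam_inl] at h0
  have ht : t 0 ≠ 0 := left_ne_zero_of_mul h0
  have hc : c 0 ^ m ≠ 0 := by simpa using right_ne_zero_of_mul h0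
  have key : ∀ i : Fin (m + 1),
      c 0 ^ (m - (i : ℕ)) * c 1 ^ (i : ℕ) = c 0 ^ m * (c 1 / c 0) ^ (i : ℕ) := by
    intro i
    rcases Nat.eq_zero_or_pos m with h | h
    · subst h
      have : (i : ℕ) = 0 := by omega
      simp
    · have hc0 : c 0 ≠ 0 := fun e => hc (by rw [e, zero_pow h.ne'])
      rw [div_pow, mul_div_assoc', eq_div_iff (pow_ne_zero _ hc0), mul_right_comm, ← pow_add,
        Nat.sub_add_cancel (Nat.lt_succ_iff.1 i.2)]
  refine ⟨t 0 * c 0 ^ m, c 1 / c 0, t 1 / t 0, ?_⟩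
  ext (i | i)
  · simp [rulingParam_inl, scrollVector, key, mul_assoc]
  · simp only [rulingParam_inr, scrollVector, key, Pi.smul_apply, Sum.elim_inr, smul_eq_mul]
    field_simp

/-- The cone over the scroll is irreducible: a polynomial that vanishes on a nonempty basic open
subset vanishes everywhere. It holds because the cone is the image of an affine space. -/
theorem eval_eq_zero_of_mem_scrollCone [Infinite k]
    {P Q : MvPolynomial (Fin (m + 1) ⊕ Fin (m + 1)) k}
    (hPQ : ∀ x ∈ scrollCone k m, eval x Q ≠ 0 → eval x P = 0)
    (hQ : ∃ x ∈ scrollCone k m, eval x Q ≠ 0) {x : Fin (m + 1) ⊕ Fin (m + 1) → k}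
    (hx : x ∈ scrollCone k m) : eval x P = 0 := by
  -- The parametrization `rulingParam` with indeterminates `c` (left) and `t` (right).
  let π : Fin (m + 1) ⊕ Fin (m + 1) → MvPolynomial (Fin 2 ⊕ Fin 2) k :=
    Sum.elim
      (fun i => X (Sum.inr 0) * (X (Sum.inl 0) ^ (m - (i : ℕ)) * X (Sum.inl 1) ^ (i : ℕ)))
      (fun i => X (Sum.inr 1) * (X (Sum.inl 0) ^ (m - (i : ℕ)) * X (Sum.inl 1) ^ (i : ℕ)))
  have hπ : ∀ (u : Fin 2 ⊕ Fin 2 → k) (F : MvPolynomial (Fin (m + 1) ⊕ Fin (m + 1)) k),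
      eval u (bind₁ π F) = eval (rulingParam m (u ∘ Sum.inl) (u ∘ Sum.inr)) F := by
    intro u F
    rw [← coe_aeval_eq_eval, RingHom.coe_coe, aeval_bind₁, ← coe_aeval_eq_eval, RingHom.coe_coe]
    congr 2
    ext (i | i) <;> simp [π, rulingParam_inl, rulingParam_inr]
  have hmul : bind₁ π P * bind₁ π Q = 0 := by
    refine MvPolynomial.funext fun u => ?_
    rw [map_mul, map_zero, hπ, hπ, mul_eq_zero, or_iff_not_imp_right]
    exact hPQ _ (rulingParam_mem_scrollCone _ _)
  rcases mul_eq_zero.1 hmul with h | h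
  · obtain ⟨c, t, rfl⟩ := mem_scrollCone_iff_exists_rulingParam.1 hx
    simpa [h] using (hπ (Sum.elim c t) P).symm
  · obtain ⟨x, hx, hxQ⟩ := hQ
    obtain ⟨c, t, rfl⟩ := mem_scrollCone_iff_exists_rulingParam.1 hx
    exact absurd (by simpa [h] using (hπ (Sum.elim c t) Q).symm) hxQ

end Ruling

/-! ### Quadrics containing the scroll -/

section Quadrics

variable {k : Type*} [Field k]

/-- The bilinear forms `B` whose quadratic form `x ↦ B x x` vanishes on `C`. For `C` a cone this is
the space of the quadrics through `C`, enlarged by the alternating forms. -/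
def quadricsOn {V : Type*} [AddCommGroup V] [Module k V] (C : Set V) :
    Submodule k (LinearMap.BilinForm k V) where
  carrier := {B | ∀ x ∈ C, B x x = 0}
  add_mem' {A B} hA hB x hx := by simp [hA x hx, hB x hx]
  zero_mem' x _ := by simp
  smul_mem' a B hB x hx := by simp [hB x hx]

theorem mem_quadricsOn {V : Type*} [AddCommGroup V] [Module k V] {C : Set V}
    {B : LinearMap.BilinForm k V} : B ∈ quadricsOn C ↔ ∀ x ∈ C, B x x = 0 := Iff.rfl

/-- The action of an endomorphism `A` on bilinear forms as a derivation. -/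
def bilinDerivation {V : Type*} [AddCommGroup V] [Module k V] (A : Module.End k V) :
    Module.End k (LinearMap.BilinForm k V) where
  toFun B := B.compLeft A + B.compRight A
  map_add' B B' := by ext; simp [add_add_add_comm]
  map_smul' a B := by ext; simp

theorem bilinDerivation_apply {V : Type*} [AddCommGroup V] [Module k V] (A : Module.End k V)
    (B : LinearMap.BilinForm k V) (x y : V) :
    bilinDerivation A B x y = B (A x) y + B x (A y) := rfl

theorem bilin_apply_eq_sum {ι : Type*} [Fintype ι] [DecidableEq ι]
    (B : LinearMap.BilinForm k (ι → k)) (x y : ι → k) :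
    B x y = ∑ i, ∑ j, B (Pi.single i 1) (Pi.single j 1) * (x i * y j) := by
  conv_lhs => rw [← Matrix.toBilin'_toMatrix' B, Matrix.toBilin'_apply]
  refine Finset.sum_congr rfl fun i _ => Finset.sum_congr rfl fun j _ => ?_
  rw [LinearMap.BilinForm.toMatrix'_apply]
  ring

/-- The quadratic form of a bilinear form, as a polynomial. -/
def bilinPoly {ι : Type*} [Fintype ι] [DecidableEq ι] (B : LinearMap.BilinForm k (ι → k)) :
    MvPolynomial ι k :=
  ∑ i, ∑ j, C (B (Pi.single i 1) (Pi.single j 1)) * (X i * X j)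

theorem eval_bilinPoly {ι : Type*} [Fintype ι] [DecidableEq ι]
    (B : LinearMap.BilinForm k (ι → k)) (x : ι → k) : eval x (bilinPoly B) = B x x := by
  simp [bilinPoly, bilin_apply_eq_sum B x x]

theorem isHomogeneous_bilinPoly {ι : Type*} [Fintype ι] [DecidableEq ι]
    (B : LinearMap.BilinForm k (ι → k)) : (bilinPoly B).IsHomogeneous 2 :=
  IsHomogeneous.sum _ _ _ fun i _ => IsHomogeneous.sum _ _ _ fun j _ => by
    simpa using (isHomogeneous_C _ _).mul ((isHomogeneous_X k i).mul (isHomogeneous_X k j))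

/-- A linear form, as a polynomial. -/
def linPoly {ι : Type*} [Fintype ι] [DecidableEq ι] (l : (ι → k) →ₗ[k] k) : MvPolynomial ι k :=
  ∑ i, C (l (Pi.single i 1)) * X i

theorem eval_linPoly {ι : Type*} [Fintype ι] [DecidableEq ι] (l : (ι → k) →ₗ[k] k) (x : ι → k) :
    eval x (linPoly l) = l x := by
  rw [LinearMap.pi_apply_eq_sum_univ l x]
  simp only [linPoly, map_sum, map_mul, eval_C, eval_X, smul_eq_mul]
  refine Finset.sum_congr rfl fun i _ => ?_
  rw [mul_comm]
  congr 2
  ext j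
  simp [Pi.single_apply, eq_comm]

theorem isHomogeneous_linPoly {ι : Type*} [Fintype ι] [DecidableEq ι] (l : (ι → k) →ₗ[k] k) :
    (linPoly l).IsHomogeneous 1 :=
  IsHomogeneous.sum _ _ _ fun i _ => by
    simpa using (isHomogeneous_C _ _).mul (isHomogeneous_X k i)

theorem eval_smul_of_isHomogeneous {ι : Type*} {F : MvPolynomial ι k} {d : ℕ}
    (hF : F.IsHomogeneous d) (a : k) (x : ι → k) : eval (a • x) F = a ^ d * eval x F := by
  rw [eval_eq, eval_eq, Finset.mul_sum]
  refine Finset.sum_congr rfl fun e he => ?_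
  have : e.sum (fun _ n => n) = d := by
    rw [← hF (mem_support_iff.1 he), Finsupp.weight_apply]
    simp
  rw [← this, Finsupp.sum, ← Finset.prod_pow_eq_pow_sum]
  simp only [Pi.smul_apply, smul_eq_mul, mul_pow, Finset.prod_mul_distrib]
  ring

theorem eval_rep_mk_eq_zero_iff {ι : Type*} {F : MvPolynomial ι k} {d : ℕ}
    (hF : F.IsHomogeneous d) {x : ι → k} (hx : x ≠ 0) :
    eval (Projectivization.mk k x hx).rep F = 0 ↔ eval x F = 0 := by
  obtain ⟨a, ha⟩ := Projectivization.exists_smul_eq_mk_rep k x hx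
  rw [← ha, Units.smul_def, eval_smul_of_isHomogeneous hF]
  simp

variable {m : ℕ}

/-- The quadric given by the minor of the columns `i` and `j` of the `2 × 2m` matrix. -/
def minorForm (k : Type*) [Field k] (i j : Fin m ⊕ Fin m) :
    LinearMap.BilinForm k (Fin (m + 1) ⊕ Fin (m + 1) → k) :=
  LinearMap.BilinForm.linMulLin (LinearMap.proj (scrollLo i)) (LinearMap.proj (scrollHi j)) -
    LinearMap.BilinForm.linMulLin (LinearMap.proj (scrollHi i)) (LinearMap.proj (scrollLo j))

theorem minorForm_apply_self (i j : Fin m ⊕ Fin m) (x : Fin (m + 1) ⊕ Fin (m + 1) → k) :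
    minorForm k i j x x = x (scrollLo i) * x (scrollHi j) - x (scrollHi i) * x (scrollLo j) := rfl

theorem mem_scrollCone_iff_quadricsOn {x : Fin (m + 1) ⊕ Fin (m + 1) → k} :
    x ∈ scrollCone k m ↔ ∀ B ∈ quadricsOn (k := k) (scrollCone k m), B x x = 0 := by
  refine ⟨fun hx B hB => hB x hx, fun h => mem_scrollCone_of_minors fun i j => sub_eq_zero.1 ?_⟩
  refine h (minorForm k i j) fun y hy => ?_
  rw [minorForm_apply_self, sub_eq_zero]
  exact minors_of_mem_scrollCone hy i j

/-- The scroll consists of the points on the lines of the ruling. -/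
theorem mem_scroll_iff [Infinite k] {p : ℙ k (Fin (m + 1) ⊕ Fin (m + 1) → k)} :
    p ∈ scroll k m m ↔ p.rep ∈ scrollCone k m := by
  constructor
  · intro hp
    refine mem_scrollCone_of_minors fun i j => ?_
    rw [← sub_eq_zero, ← minorForm_apply_self, ← eval_bilinPoly]
    refine hp 2 _ (isHomogeneous_bilinPoly _) ?_
    rintro _ ⟨st, rfl⟩
    rw [eval_rep_mk_eq_zero_iff (isHomogeneous_bilinPoly _), eval_bilinPoly, minorForm_apply_self,
      sub_eq_zero]
    exact minors_of_mem_scrollCone (scrollVector_mem_scrollCone _ _) i j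
  · intro hp d F hF h
    refine eval_eq_zero_of_mem_scrollCone (Q := X (Sum.inl 0)) (fun x hx h0 => ?_)
      ⟨_, scrollVector_mem_scrollCone 0 0, by simp [scrollVector]⟩ hp
    obtain ⟨a, s, t, rfl⟩ := eq_smul_scrollVector hx (by simpa using h0)
    have := h _ ⟨(s, t), rfl⟩
    rw [eval_rep_mk_eq_zero_iff hF] at this
    rw [eval_smul_of_isHomogeneous hF, this, mul_zero]

theorem mk_mem_scroll_iff [Infinite k] {x : Fin (m + 1) ⊕ Fin (m + 1) → k} (hx : x ≠ 0) :
    Projectivization.mk k x hx ∈ scroll k m m ↔ x ∈ scrollCone k m := by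
  obtain ⟨a, ha⟩ := Projectivization.exists_smul_eq_mk_rep k x hx
  rw [mem_scroll_iff, ← ha]
  refine ⟨fun h => ?_, fun h => smul_mem_scrollCone h _⟩
  simpa [Units.smul_def, smul_smul] using smul_mem_scrollCone h (↑a⁻¹ : k)

theorem mem_quadricsOn_scrollCone [Infinite k]
    {B : LinearMap.BilinForm k (Fin (m + 1) ⊕ Fin (m + 1) → k)}
    (hB : ∀ s t, B (scrollVector m m s t) (scrollVector m m s t) = 0) :
    B ∈ quadricsOn (scrollCone k m) := by
  intro x hx
  by_cases h0 : x = 0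
  · simp [h0]
  rw [← eval_bilinPoly, ← eval_rep_mk_eq_zero_iff (isHomogeneous_bilinPoly _) h0]
  refine (mk_mem_scroll_iff h0).2 hx 2 _ (isHomogeneous_bilinPoly _) ?_
  rintro _ ⟨st, rfl⟩
  rw [eval_rep_mk_eq_zero_iff (isHomogeneous_bilinPoly _), eval_bilinPoly]
  exact hB _ _

/-- The scroll is not contained in a hyperplane. -/
theorem eq_zero_of_forall_scrollCone [Infinite k] {l : (Fin (m + 1) ⊕ Fin (m + 1) → k) →ₗ[k] k}
    (hl : ∀ x ∈ scrollCone k m, l x = 0) : l = 0 := by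
  have key : ∀ f : Fin (m + 1) → k, (∀ s : k, ∑ i, f i * s ^ (i : ℕ) = 0) → f = 0 := by
    intro f hf
    have hp : ∑ i : Fin (m + 1), Polynomial.monomial (i : ℕ) (f i) = 0 :=
      Polynomial.funext fun s => by simpa [Polynomial.eval_finsetSum] using hf s
    ext i
    have := congrArg (fun p => Polynomial.coeff p (i : ℕ)) hp
    simpa [Polynomial.finsetSum_coeff, Polynomial.coeff_monomial, Fin.val_inj] using this
  have hst : ∀ s t : k, ∑ i, l (Pi.single (Sum.inl i) 1) * s ^ (i : ℕ) +
      t * ∑ i, l (Pi.single (Sum.inr i) 1) * s ^ (i : ℕ) = 0 := by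
    intro s t
    rw [← hl _ (scrollVector_mem_scrollCone s t), ← eval_linPoly]
    simp only [linPoly, scrollVector, map_sum, map_add, map_mul, eval_C, eval_X,
      Fintype.sum_sum_type, Sum.elim_inl, Sum.elim_inr, Finset.mul_sum]
    congr 1
    exact Finset.sum_congr rfl fun i _ => by ring
  have h0 := key (fun i => l (Pi.single (Sum.inl i) 1)) fun s => by simpa using hst s 0
  have h1 := key (fun i => l (Pi.single (Sum.inr i) 1)) fun s => by
    linear_combination hst s 1 - hst s 0
  refine LinearMap.pi_ext' fun i => LinearMap.ext_ring ?_
  rcases i with i | i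
  · simpa using congrFun h0 i
  · simpa using congrFun h1 i

theorem eq_zero_or_eq_zero_of_mul_scrollCone [Infinite k]
    {l l' : (Fin (m + 1) ⊕ Fin (m + 1) → k) →ₗ[k] k}
    (h : ∀ x ∈ scrollCone k m, l x * l' x = 0) : l = 0 ∨ l' = 0 := by
  rw [or_iff_not_imp_right]
  intro hl'
  refine eq_zero_of_forall_scrollCone fun x hx => ?_
  rw [← eval_linPoly]
  refine eval_eq_zero_of_mem_scrollCone (Q := linPoly l') (fun y hy hy' => ?_) ?_ hx
  · rw [eval_linPoly] at hy' ⊢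
    exact (mul_eq_zero.1 (h y hy)).resolve_right hy'
  · by_contra! hQ
    exact hl' (eq_zero_of_forall_scrollCone fun x hx => by rw [← eval_linPoly]; exact hQ x hx)

end Quadrics

/-! ### Quadrics through a surface with infinitesimal symmetries -/

section Weights

variable {k : Type*} [Field k] {m : ℕ}

/-- The index `i` of the coordinate `x_{a,i}`. -/
def coordDegree (α : Fin (m + 1) ⊕ Fin (m + 1)) : ℕ := Sum.elim Fin.val Fin.val α

/-- The coordinate `x_{a,i-1}` that precedes `x_{a,i}`. For `i = 0`, where there is none, the value
is immaterial. -/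
def coordPred : Fin (m + 1) ⊕ Fin (m + 1) → Fin (m + 1) ⊕ Fin (m + 1) :=
  Sum.map (fun i => ⟨(i : ℕ) - 1, by omega⟩) (fun i => ⟨(i : ℕ) - 1, by omega⟩)

theorem coordDegree_coordPred (α : Fin (m + 1) ⊕ Fin (m + 1)) :
    coordDegree (coordPred α) = coordDegree α - 1 := by
  rcases α with i | i <;> rfl

/-- The vector field `x_{a,i} ↦ i x_{a,i}`; along the curves `s ↦ scrollVector m m s t` it is
`s d/ds`. -/
def degreeOp (k : Type*) [Field k] (m : ℕ) : Module.End k (Fin (m + 1) ⊕ Fin (m + 1) → k) where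
  toFun x α := coordDegree α * x α
  map_add' x y := by ext; simp [mul_add]
  map_smul' a x := by ext; simp [mul_left_comm]

/-- The vector field `x_{a,i} ↦ i x_{a,i-1}`; along the curves `s ↦ scrollVector m m s t` it is
`d/ds`. -/
def lowerOp (k : Type*) [Field k] (m : ℕ) : Module.End k (Fin (m + 1) ⊕ Fin (m + 1) → k) where
  toFun x α := coordDegree α * x (coordPred α)
  map_add' x y := by ext; simp [mul_add]
  map_smul' a x := by ext; simp [mul_left_comm]

theorem degreeOp_apply (x : Fin (m + 1) ⊕ Fin (m + 1) → k) (α : Fin (m + 1) ⊕ Fin (m + 1)) :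
    degreeOp k m x α = coordDegree α * x α := rfl

theorem lowerOp_apply (x : Fin (m + 1) ⊕ Fin (m + 1) → k) (α : Fin (m + 1) ⊕ Fin (m + 1)) :
    lowerOp k m x α = coordDegree α * x (coordPred α) := rfl

theorem degreeOp_lowerOp (x : Fin (m + 1) ⊕ Fin (m + 1) → k) :
    degreeOp k m (lowerOp k m x) = lowerOp k m (degreeOp k m x) + lowerOp k m x := by
  ext α
  simp only [degreeOp_apply, lowerOp_apply, Pi.add_apply, coordDegree_coordPred]
  rcases Nat.eq_zero_or_pos (coordDegree α) with h | h
  · simp [h]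
  · rw [Nat.cast_pred h]
    ring

theorem smul_lowerOp_scrollVector (s t : k) :
    s • lowerOp k m (scrollVector m m s t) = degreeOp k m (scrollVector m m s t) := by
  have key : ∀ i : ℕ, s * (i * s ^ (i - 1)) = i * s ^ i := by
    rintro (_ | i)
    · simp
    · simp [pow_succ]
      ring
  ext (i | i)
  · exact key i
  · simp only [Pi.smul_apply, degreeOp_apply, lowerOp_apply, smul_eq_mul, scrollVector, coordPred,
      coordDegree, Sum.map_inr, Sum.elim_inr]
    linear_combination t * key i

theorem degreeOp_single (α : Fin (m + 1) ⊕ Fin (m + 1)) :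
    degreeOp k m (Pi.single α 1) = (coordDegree α : k) • Pi.single α 1 := by
  ext β
  by_cases h : β = α
  · subst h
    simp [degreeOp_apply]
  · simp [degreeOp_apply, h]

/-- The lowering operator lowers the weight of a bilinear form by one. -/
theorem bilinDerivation_lowerOp_weight {B : LinearMap.BilinForm k (Fin (m + 1) ⊕ Fin (m + 1) → k)}
    {c : k} (hB : bilinDerivation (degreeOp k m) B = c • B) :
    bilinDerivation (degreeOp k m) (bilinDerivation (lowerOp k m) B) =
      (c - 1) • bilinDerivation (lowerOp k m) B := by
  have h : ∀ x y, B (degreeOp k m x) y + B x (degreeOp k m y) = c * B x y := fun x y => by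
    rw [← bilinDerivation_apply, hB, LinearMap.smul_apply, LinearMap.smul_apply, smul_eq_mul]
  refine LinearMap.ext fun x => LinearMap.ext fun y => ?_
  have e1 := h (lowerOp k m x) y
  have e2 := h x (lowerOp k m y)
  rw [degreeOp_lowerOp, map_add, LinearMap.add_apply] at e1
  rw [degreeOp_lowerOp, map_add] at e2
  simp only [bilinDerivation_apply, LinearMap.smul_apply, smul_eq_mul]
  linear_combination e1 + e2

/-- The products of two coordinates are weight vectors, and they span the bilinear forms. -/
theorem iSup_eigenspace_bilinDerivation_degreeOp :
    ⨆ μ, Module.End.genEigenspace (R := k)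
      (M := LinearMap.BilinForm k (Fin (m + 1) ⊕ Fin (m + 1) → k))
      (bilinDerivation (degreeOp k m)) μ 1 = ⊤ := by
  refine eq_top_iff.2 fun B _ => ?_
  have hB : B = ∑ α, ∑ β, B (Pi.single α 1) (Pi.single β 1) •
      LinearMap.BilinForm.linMulLin (LinearMap.proj α) (LinearMap.proj β) := by
    refine LinearMap.ext fun x => LinearMap.ext fun y => ?_
    rw [bilin_apply_eq_sum]
    simp
  rw [hB]
  refine Submodule.sum_mem _ fun α _ => Submodule.sum_mem _ fun β _ => Submodule.smul_mem _ _ ?_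
  refine Submodule.mem_iSup_of_mem ((coordDegree α : k) + coordDegree β) ?_
  refine Module.End.mem_genEigenspace_one.2 ?_
  refine LinearMap.ext fun x => LinearMap.ext fun y => ?_
  simp only [bilinDerivation_apply, LinearMap.BilinForm.linMulLin_apply, LinearMap.proj_apply,
    degreeOp_apply, LinearMap.smul_apply, smul_eq_mul]
  ring

theorem exists_natCast_of_weight {B : LinearMap.BilinForm k (Fin (m + 1) ⊕ Fin (m + 1) → k)}
    {c : k} (hB : bilinDerivation (degreeOp k m) B = c • B) (h0 : B ≠ 0) : ∃ d : ℕ, c = d := by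
  by_contra! hc
  refine h0 (LinearMap.ext fun x => LinearMap.ext fun y => ?_)
  rw [bilin_apply_eq_sum]
  refine Finset.sum_eq_zero fun α _ => Finset.sum_eq_zero fun β _ => ?_
  have h := congrArg (fun B => B (Pi.single α 1) (Pi.single β 1)) hB
  simp only [bilinDerivation_apply, degreeOp_single, map_smul, LinearMap.smul_apply,
    smul_eq_mul] at h
  have : (c - ((coordDegree α + coordDegree β : ℕ) : k)) *
      B (Pi.single α 1) (Pi.single β 1) = 0 := by
    push_cast
    linear_combination -h
  rw [(mul_eq_zero.1 this).resolve_left (sub_ne_zero.2 (hc _)), zero_mul]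

/-- A bilinear form of weight `0` involves only the coordinates `x_{0,0}` and `x_{1,0}`. Its
quadratic form is then a product of linear forms. -/
theorem exists_factorization_of_weight_zero [IsAlgClosed k] [CharZero k]
    {B : LinearMap.BilinForm k (Fin (m + 1) ⊕ Fin (m + 1) → k)}
    (hB : bilinDerivation (degreeOp k m) B = 0) :
    ∃ l l' : (Fin (m + 1) ⊕ Fin (m + 1) → k) →ₗ[k] k, ∀ x, B x x = l x * l' x := by
  have h0 : ∀ α β : Fin (m + 1) ⊕ Fin (m + 1), coordDegree α + coordDegree β ≠ 0 →
      B (Pi.single α 1) (Pi.single β 1) = 0 := by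
    intro α β hαβ
    have h := congrArg (fun B => B (Pi.single α 1) (Pi.single β 1)) hB
    simp only [bilinDerivation_apply, degreeOp_single, map_smul, LinearMap.smul_apply,
      smul_eq_mul, LinearMap.zero_apply] at h
    rw [← add_mul, ← Nat.cast_add] at h
    exact (mul_eq_zero.1 h).resolve_left (Nat.cast_ne_zero.2 hαβ)
  have hs : ∀ (f : Fin (m + 1) ⊕ Fin (m + 1) → k), (∀ α, coordDegree α ≠ 0 → f α = 0) →
      ∑ α, f α = f (Sum.inl 0) + f (Sum.inr 0) := by
    intro f hf
    rw [Fintype.sum_sum_type, Finset.sum_eq_single 0, Finset.sum_eq_single 0]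
    · exact fun i _ hi => hf (Sum.inr i) (by simpa [coordDegree] using hi)
    · simp
    · exact fun i _ hi => hf (Sum.inl i) (by simpa [coordDegree] using hi)
    · simp
  set a := B (Pi.single (Sum.inl 0) 1) (Pi.single (Sum.inl 0) 1)
  set b := B (Pi.single (Sum.inl 0) 1) (Pi.single (Sum.inr 0) 1) +
    B (Pi.single (Sum.inr 0) 1) (Pi.single (Sum.inl 0) 1)
  set c := B (Pi.single (Sum.inr 0) 1) (Pi.single (Sum.inr 0) 1)
  have hx : ∀ x, B x x = a * x (Sum.inl 0) ^ 2 + b * (x (Sum.inl 0) * x (Sum.inr 0)) +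
      c * x (Sum.inr 0) ^ 2 := by
    intro x
    rw [bilin_apply_eq_sum, hs, hs, hs]
    · ring
    · exact fun β hβ => by rw [h0 _ _ (by omega), zero_mul]
    · exact fun β hβ => by rw [h0 _ _ (by omega), zero_mul]
    · exact fun α hα => Finset.sum_eq_zero fun β _ => by rw [h0 _ _ (by omega), zero_mul]
  let p₀ : (Fin (m + 1) ⊕ Fin (m + 1) → k) →ₗ[k] k := LinearMap.proj (Sum.inl 0)
  let p₁ : (Fin (m + 1) ⊕ Fin (m + 1) → k) →ₗ[k] k := LinearMap.proj (Sum.inr 0)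
  by_cases hc : c = 0
  · refine ⟨p₀, a • p₀ + b • p₁, fun x => ?_⟩
    rw [hx, hc]
    simp only [p₀, p₁, LinearMap.add_apply, LinearMap.smul_apply, LinearMap.proj_apply,
      smul_eq_mul]
    ring
  · -- `r` is a root of `c z² + b z + a`, where `z` stands for `x_{1,0} / x_{0,0}`.
    obtain ⟨r, hr⟩ := IsAlgClosed.exists_root
      (Polynomial.C c * Polynomial.X ^ 2 + Polynomial.C b * Polynomial.X + Polynomial.C a)
      (by rw [Polynomial.degree_quadratic hc]; decide)
    have hr' : c * r ^ 2 + b * r + a = 0 := by simpa using hr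
    refine ⟨p₁ - r • p₀, c • p₁ + (b + c * r) • p₀, fun x => ?_⟩
    rw [hx]
    simp only [p₀, p₁, LinearMap.add_apply, LinearMap.sub_apply, LinearMap.smul_apply,
      LinearMap.proj_apply, smul_eq_mul]
    linear_combination x (Sum.inl 0) ^ 2 * hr'

/-- If `C` is irreducible and not contained in a hyperplane, and if the space of the quadrics
through `C` is stable under the vector fields `degreeOp` and `lowerOp`, then every quadric through
`C` contains the scroll. A quadric may be taken to be homogeneous for the weights of `degreeOp`. On
the scroll, lowering it is differentiating it, which divides it by `s` and multiplies it by its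
weight; so repeated lowering reduces the claim to weight `0`. A quadric of weight `0` is the union
of two hyperplanes, and hence does not contain `C`. -/
theorem quadricsOn_le_quadricsOn_scrollCone [IsAlgClosed k] [CharZero k]
    {C : Set (Fin (m + 1) ⊕ Fin (m + 1) → k)}
    (hC : ∀ l l' : (Fin (m + 1) ⊕ Fin (m + 1) → k) →ₗ[k] k,
      (∀ x ∈ C, l x * l' x = 0) → l = 0 ∨ l' = 0)
    (hD : ∀ B ∈ quadricsOn (k := k) C, bilinDerivation (degreeOp k m) B ∈ quadricsOn (k := k) C)
    (hE : ∀ B ∈ quadricsOn (k := k) C, bilinDerivation (lowerOp k m) B ∈ quadricsOn (k := k) C) :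
    quadricsOn (k := k) C ≤ quadricsOn (k := k) (scrollCone k m) := by
  have key : ∀ (d : ℕ), ∀ B ∈ quadricsOn (k := k) C,
      bilinDerivation (degreeOp k m) B = (d : k) • B →
      ∀ s t, B (scrollVector m m s t) (scrollVector m m s t) = 0 := by
    intro d
    induction d with
    | zero =>
      intro B hB h s t
      obtain ⟨l, l', hl⟩ := exists_factorization_of_weight_zero (by simpa using h)
      rw [hl]
      rcases hC l l' (fun x hx => by rw [← hl]; exact hB x hx) with h | h <;> simp [h]
    | succ d ih =>
      -- `s` times the restriction of the lowered form is `d + 1` times the restriction of `B`.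
      intro B hB h s t
      have h1 := ih _ (hE B hB) (by simpa using bilinDerivation_lowerOp_weight h) s t
      have h2 := congrArg (fun B => B (scrollVector m m s t) (scrollVector m m s t)) h
      simp only [bilinDerivation_apply, ← smul_lowerOp_scrollVector, map_smul,
        LinearMap.smul_apply, smul_eq_mul] at h1 h2
      have h3 : ((d + 1 : ℕ) : k) * B (scrollVector m m s t) (scrollVector m m s t) = 0 := by
        linear_combination s * h1 - h2
      exact (mul_eq_zero.1 h3).resolve_left (Nat.cast_ne_zero.2 d.succ_ne_zero)
  rw [Submodule.eq_iSup_inf_genEigenspace 1 hD iSup_eigenspace_bilinDerivation_degreeOp]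
  refine iSup_le fun μ B hB => ?_
  have hμ : bilinDerivation (degreeOp k m) B = μ • B := Module.End.mem_genEigenspace_one.1 hB.2
  by_cases h0 : B = 0
  · rw [h0]
    exact Submodule.zero_mem _
  obtain ⟨d, rfl⟩ := exists_natCast_of_weight hμ h0
  exact mem_quadricsOn_scrollCone (key d B hB.1 hμ)

theorem congr_mem_quadricsOn_iff {V : Type*} [AddCommGroup V] [Module k V] (T : V ≃ₗ[k] V)
    {C : Set V} {B : LinearMap.BilinForm k V} :
    LinearMap.BilinForm.congr T B ∈ quadricsOn C ↔ B ∈ quadricsOn (T ⁻¹' C) := by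
  refine ⟨fun h y hy => ?_, fun h y hy => ?_⟩
  · simpa using h (T y) hy
  · simpa using h (T.symm y) (by simpa using hy)

theorem finrank_quadricsOn_preimage {V : Type*} [AddCommGroup V] [Module k V] (T : V ≃ₗ[k] V)
    (C : Set V) : Module.finrank k (quadricsOn (k := k) (T ⁻¹' C)) =
      Module.finrank k (quadricsOn (k := k) C) := by
  have hmap : (quadricsOn (k := k) (T ⁻¹' C)).map (LinearMap.BilinForm.congr T).toLinearMap =
      quadricsOn C := by
    ext B
    rw [Submodule.mem_map_equiv, ← congr_mem_quadricsOn_iff, LinearEquiv.apply_symm_apply]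
  rw [← hmap, LinearEquiv.finrank_map_eq]

theorem quadricsOn_preimage_eq_of_le {V : Type*} [AddCommGroup V] [Module k V]
    [FiniteDimensional k V] (T : V ≃ₗ[k] V) {C : Set V}
    (h : quadricsOn (k := k) (T ⁻¹' C) ≤ quadricsOn (k := k) C) :
    quadricsOn (k := k) (T ⁻¹' C) = quadricsOn (k := k) C :=
  Submodule.eq_of_le_of_finrank_eq (V := LinearMap.BilinForm k V) h
    (finrank_quadricsOn_preimage T C)

theorem forall_quadricsOn_preimage_iff {V : Type*} [AddCommGroup V] [Module k V] (T : V ≃ₗ[k] V)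
    {C : Set V} {x : V} : (∀ B ∈ quadricsOn (k := k) (T ⁻¹' C), B x x = 0) ↔
      ∀ B ∈ quadricsOn (k := k) C, B (T x) (T x) = 0 := by
  refine ⟨fun h B hB => ?_, fun h B hB => ?_⟩
  · simpa using h ((LinearMap.BilinForm.congr T).symm B)
      (by rwa [← congr_mem_quadricsOn_iff, LinearEquiv.apply_symm_apply])
  · simpa using h _ ((congr_mem_quadricsOn_iff T).2 hB)

/-- A surface with the symmetries of `quadricsOn_le_quadricsOn_scrollCone` that is linearly
isomorphic to the scroll is the scroll itself: both are intersections of quadrics, and the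
spaces of quadrics have the same dimension. -/
theorem mem_scrollCone_iff_of_stable [IsAlgClosed k] [CharZero k]
    (T : (Fin (m + 1) ⊕ Fin (m + 1) → k) ≃ₗ[k] (Fin (m + 1) ⊕ Fin (m + 1) → k))
    (hD : ∀ B ∈ quadricsOn (k := k) (T ⁻¹' scrollCone k m),
      bilinDerivation (degreeOp k m) B ∈ quadricsOn (k := k) (T ⁻¹' scrollCone k m))
    (hE : ∀ B ∈ quadricsOn (k := k) (T ⁻¹' scrollCone k m),
      bilinDerivation (lowerOp k m) B ∈ quadricsOn (k := k) (T ⁻¹' scrollCone k m))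
    (x : Fin (m + 1) ⊕ Fin (m + 1) → k) :
    T x ∈ scrollCone k m ↔ x ∈ scrollCone k m := by
  have : Infinite k := IsAlgClosed.instInfinite
  have hle : quadricsOn (k := k) (T ⁻¹' scrollCone k m) ≤ quadricsOn (k := k) (scrollCone k m) := by
    refine quadricsOn_le_quadricsOn_scrollCone (fun l l' h => ?_) hD hE
    have := eq_zero_or_eq_zero_of_mul_scrollCone (l := l ∘ₗ T.symm.toLinearMap)
      (l' := l' ∘ₗ T.symm.toLinearMap) (fun x hx => h (T.symm x) (by simpa using hx))
    refine this.imp (fun h => ?_) (fun h => ?_) <;>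
    · refine LinearMap.ext fun x => ?_
      simpa using congrArg (fun f => f (T x)) h
  have heq : quadricsOn (k := k) (T ⁻¹' scrollCone k m) = quadricsOn (k := k) (scrollCone k m) :=
    quadricsOn_preimage_eq_of_le T hle
  rw [mem_scrollCone_iff_quadricsOn, mem_scrollCone_iff_quadricsOn,
    ← forall_quadricsOn_preimage_iff, heq]

end Weights

/-! ### Tangent matrices act on the quadrics through a variety -/

section Tangent

variable {k : Type*} [Field k] {ι : Type*}

/-- The affine cone over a subset of a projective space; it contains the zero vector. -/
def coneOf (X : Set (ℙ k (ι → k))) : Set (ι → k) :=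
  {x | ∀ hx : x ≠ 0, Projectivization.mk k x hx ∈ X}

theorem mulVec_mem_coneOf [Fintype ι] [DecidableEq ι] {X : Set (ℙ k (ι → k))} {g : GL ι k}
    (hg : g ∈ projStabilizer X)
    {x : ι → k} (hx : x ∈ coneOf X) : (g : Matrix ι ι k) *ᵥ x ∈ coneOf X := by
  intro h
  have hx0 : x ≠ 0 := fun h0 => h (by simp [h0])
  have hX : Matrix.GeneralLinearGroup.toLin g • X = X := hg
  rw [← hX]
  exact Set.smul_mem_smul_set (a := Matrix.GeneralLinearGroup.toLin g) (hx hx0)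

/-- Differentiating the condition `B (g x) (g x) = 0` at `g = 1` in the direction `M`. -/
theorem IsTangentAtOne.bilinDerivation_mem [Fintype ι] [DecidableEq ι] {X : Set (ℙ k (ι → k))}
    {M : Matrix ι ι k} (hM : IsTangentAtOne (projStabilizer X) M) 
    {B : LinearMap.BilinForm k (ι → k)} (hB : B ∈ quadricsOn (coneOf X)) :
    bilinDerivation M.mulVecLin B ∈ quadricsOn (coneOf X) := by
  intro x hx
  -- `L` is the vector `g x` for a matrix `g` of indeterminates.
  set L : ι → MvPolynomial (ι × ι) k := fun i => ∑ l, C (x l) * MvPolynomial.X (i, l) with hL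
  have hF := hM (aeval L (bilinPoly B)) (by
    intro g hg
    rw [← hB _ (mulVec_mem_coneOf hg hx), ← eval_bilinPoly, ← coe_aeval_eq_eval,
      ← coe_aeval_eq_eval, RingHom.coe_coe, RingHom.coe_coe, ← AlgHom.comp_apply, comp_aeval]
    congr 2
    funext i
    simp [hL, Matrix.mulVec, dotProduct, mul_comm])
  rw [matDeriv_eq_snd, ← AlgHom.comp_apply, comp_aeval] at hF
  have hα : ∀ i, (aeval (fun ij : ι × ι => (TrivSqZeroExt.inl ((1 : Matrix ι ι k) ij.1 ij.2) +
      TrivSqZeroExt.inr (M ij.1 ij.2) : DualNumber k))) (L i) =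
      TrivSqZeroExt.inl (x i) + TrivSqZeroExt.inr ((M *ᵥ x) i) := by
    intro i
    simp only [hL, map_sum, map_mul, aeval_X, aeval_C, TrivSqZeroExt.algebraMap_eq_inl]
    ext
    · simp [TrivSqZeroExt.fst_sum, Matrix.one_apply]
    · simp [TrivSqZeroExt.snd_sum, Matrix.mulVec, dotProduct, mul_comm]
  simp only [hα, bilinPoly, map_sum, map_mul, aeval_X, aeval_C, TrivSqZeroExt.algebraMap_eq_inl,
    TrivSqZeroExt.snd_sum] at hF
  rw [bilinDerivation_apply, Matrix.mulVecLin_apply, bilin_apply_eq_sum B (M *ᵥ x),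
    bilin_apply_eq_sum B x, ← hF]
  simp only [← Finset.sum_add_distrib]
  refine Finset.sum_congr rfl fun i _ => Finset.sum_congr rfl fun j _ => ?_
  simp
  ring

/-- If the linear change of coordinates `y` carries the tangent matrix `M` to `A`, and `X` is
carried to the scroll by `g`, then `A` acts on the quadrics through the image of `X` under `y`. -/
theorem IsTangentAtOne.bilinDerivation_mem_of_intertwines [Fintype ι] [DecidableEq ι]
    {m : ℕ} {X : Set (ℙ k (ι → k))}
    {M : Matrix ι ι k} (hM : IsTangentAtOne (projStabilizer X) M)
    {y g : (ι → k) ≃ₗ[k] (Fin (m + 1) ⊕ Fin (m + 1) → k)}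
    (hg : coneOf X = g ⁻¹' scrollCone k m)
    {A : Module.End k (Fin (m + 1) ⊕ Fin (m + 1) → k)} (hA : ∀ x, y (M *ᵥ x) = A (y x))
    {B : LinearMap.BilinForm k (Fin (m + 1) ⊕ Fin (m + 1) → k)}
    (hB : B ∈ quadricsOn ((y.symm.trans g) ⁻¹' scrollCone k m)) :
    bilinDerivation A B ∈ quadricsOn ((y.symm.trans g) ⁻¹' scrollCone k m) := by
  have hB' : B.comp y.toLinearMap y.toLinearMap ∈ quadricsOn (coneOf X) := by
    intro x hx
    rw [hg] at hx
    exact hB (y x) (by simpa using hx)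
  intro z hz
  have h := hM.bilinDerivation_mem hB' (y.symm z) (by rw [hg]; exact hz)
  simpa [bilinDerivation_apply, hA] using h

theorem coneOf_eq_preimage [Infinite k] {m : ℕ} {X : Set (ℙ k (ι → k))}
    {g : (ι → k) ≃ₗ[k] (Fin (m + 1) ⊕ Fin (m + 1) → k)}
    (hg : Projectivization.map g.toLinearMap g.injective '' X = scroll k m m) :
    coneOf X = g ⁻¹' scrollCone k m := by
  ext x
  by_cases hx : x = 0
  · subst hx
    refine iff_of_true (fun h => absurd rfl h) ⟨![1, 0], fun h => one_ne_zero (congrFun h 0), ?_⟩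
    rw [map_zero]
    exact Submodule.zero_mem _
  have hgx : g x ≠ 0 := by simpa using hx
  have hmk : Projectivization.map g.toLinearMap g.injective (Projectivization.mk k x hx) =
      Projectivization.mk k (g x) hgx := Projectivization.map_mk _ _ _ _
  rw [Set.mem_preimage, ← mk_mem_scroll_iff hgx, ← hmk, ← hg,
    (Projectivization.map_injective g.toLinearMap g.injective).mem_set_image]
  exact ⟨fun h => h hx, fun h _ => h⟩

/-- A basis of the space of linear forms gives linear coordinates. -/
theorem exists_coordinates [Fintype ι] {κ : Type*} [Fintype κ] (f : Module.Basis κ k (ι → k)) :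
    ∃ y : (ι → k) ≃ₗ[k] (κ → k), ∀ x α, y x α = f α ⬝ᵥ x := by
  let y : (ι → k) →ₗ[k] (κ → k) := Matrix.mulVecLin (Matrix.of fun α => f α)
  have hy : Function.Injective y := by
    refine (injective_iff_map_eq_zero _).2 fun x hx => dotProduct_eq_zero _ fun u => ?_
    rw [← f.sum_repr u, dotProduct_sum]
    refine Finset.sum_eq_zero fun α _ => ?_
    have : f α ⬝ᵥ x = 0 := congrFun hx α
    rw [dotProduct_smul, dotProduct_comm, this, smul_zero]
  refine ⟨LinearEquiv.ofInjectiveOfFinrankEq y hy ?_, fun x α => rfl⟩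
  rw [Module.finrank_eq_card_basis f, Module.finrank_fintype_fun_eq_card]

end Tangent

/-! ### Weight bases of two copies of a symmetric power -/

section SymPower

variable {k : Type*} [Field k]

/-- The element `x` of the Chevalley basis of `sl₂`. -/
def sl2X (k : Type*) [Field k] : sl2 k :=
  ⟨!![0, 1; 0, 0], LinearMap.mem_ker.2 (by simp [Matrix.trace_fin_two])⟩

/-- The exponent of the monomial `X₀^{m-i} X₁^i`. -/
def binaryExponent (m i : ℕ) : Fin 2 →₀ ℕ := Finsupp.single 0 (m - i) + Finsupp.single 1 i

theorem binaryExponent_eq_iff {m i : ℕ} (hi : i ≤ m) (d : Fin 2 →₀ ℕ) :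
    binaryExponent m i = d ↔ d.degree = m ∧ d 1 = i := by
  rw [Finsupp.degree_eq_sum, Fin.sum_univ_two]
  constructor
  · rintro rfl
    simp [binaryExponent]
    omega
  · rintro ⟨h, rfl⟩
    ext j
    fin_cases j <;> simp [binaryExponent]
    omega

theorem isHomogeneous_binaryMonomial {m i : ℕ} (hi : i ≤ m) :
    (X 0 ^ (m - i) * X 1 ^ i : MvPolynomial (Fin 2) k).IsHomogeneous m := by
  have h := ((isHomogeneous_X k (0 : Fin 2)).pow (m - i)).mul
    ((isHomogeneous_X k (1 : Fin 2)).pow i)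
  rwa [one_mul, one_mul, Nat.sub_add_cancel hi] at h

theorem binaryMonomial_eq (m i : ℕ) :
    (X 0 ^ (m - i) * X 1 ^ i : MvPolynomial (Fin 2) k) = monomial (binaryExponent m i) 1 := by
  rw [X_pow_eq_monomial, X_pow_eq_monomial, monomial_mul, one_mul, binaryExponent]

theorem exists_basis_homogeneousSubmodule (k : Type*) [Field k] (m : ℕ) :
    ∃ b : Module.Basis (Fin (m + 1)) k (homogeneousSubmodule (Fin 2) k m),
      ∀ i, (b i : MvPolynomial (Fin 2) k) = X 0 ^ (m - (i : ℕ)) * X 1 ^ (i : ℕ) := by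
  have hle : ∀ i : Fin (m + 1), (i : ℕ) ≤ m := fun i => Nat.lt_succ_iff.1 i.2
  let b : Fin (m + 1) → homogeneousSubmodule (Fin 2) k m := fun i =>
    ⟨X 0 ^ (m - (i : ℕ)) * X 1 ^ (i : ℕ), isHomogeneous_binaryMonomial (hle i)⟩
  have hb : ∀ (c : Fin (m + 1) → k) (d : Fin 2 →₀ ℕ),
      coeff d ((∑ i, c i • b i : homogeneousSubmodule (Fin 2) k m) : MvPolynomial (Fin 2) k) =
        ∑ i : Fin (m + 1), if d.degree = m ∧ d 1 = (i : ℕ) then c i else 0 := by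
    intro c d
    rw [Submodule.coe_sum, coeff_sum]
    refine Finset.sum_congr rfl fun i _ => ?_
    rw [Submodule.coe_smul, coeff_smul]
    change c i • coeff d (X 0 ^ (m - (i : ℕ)) * X 1 ^ (i : ℕ)) = _
    rw [binaryMonomial_eq, coeff_monomial, smul_eq_mul, mul_ite, mul_one, mul_zero]
    simp only [binaryExponent_eq_iff (hle i)]
  refine ⟨Module.Basis.mk (v := b) ?_ ?_, fun i => by rw [Module.Basis.mk_apply]⟩
  · refine Fintype.linearIndependent_iff.2 fun c hc i => ?_
    have h := hb c (binaryExponent m i)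
    have h' := (binaryExponent_eq_iff (hle i) _).1 rfl
    rw [hc] at h
    simpa [h'.1, h'.2, Fin.val_inj] using h.symm
  · intro P _
    have : P = ∑ i : Fin (m + 1),
        coeff (binaryExponent m i) (P : MvPolynomial (Fin 2) k) • b i := by
      ext d
      rw [hb]
      by_cases hd : d.degree = m
      · have hd1 : d 1 < m + 1 := by
          rw [Finsupp.degree_eq_sum, Fin.sum_univ_two] at hd
          omega
        rw [Finset.sum_eq_single ⟨d 1, hd1⟩]
        · rw [if_pos ⟨hd, rfl⟩, (binaryExponent_eq_iff (hle ⟨d 1, hd1⟩) d).2 ⟨hd, rfl⟩]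
        · exact fun i _ hi => if_neg fun h => hi (Fin.ext h.2.symm)
        · simp
      · rw [(P.2 : (P : MvPolynomial (Fin 2) k).IsHomogeneous m).coeff_eq_zero hd]
        exact (Finset.sum_eq_zero fun i _ => if_neg fun h => hd h.1).symm
    rw [this]
    exact Submodule.sum_mem _ fun i _ => Submodule.smul_mem _ _ (Submodule.subset_span ⟨i, rfl⟩)

theorem symDerivation_binaryMonomial (A : Matrix (Fin 2) (Fin 2) k) (a b : ℕ) :
    symDerivation A (X 0 ^ a * X 1 ^ b) =
      (b : MvPolynomial (Fin 2) k) * X 0 ^ a * X 1 ^ (b - 1) * (C (A 0 1) * X 0 + C (A 1 1) * X 1) +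
      (a : MvPolynomial (Fin 2) k) * X 0 ^ (a - 1) * X 1 ^ b *
        (C (A 0 0) * X 0 + C (A 1 0) * X 1) := by
  simp [symDerivation, Derivation.leibniz, Derivation.leibniz_pow, mkDerivation_X]
  ring

/-- The basis consists of the `m^i X₀^{m-i} X₁^i`. -/
theorem exists_weight_basis_symPower [CharZero k] {m : ℕ} (hm : 1 ≤ m) :
    ∃ b : Module.Basis (Fin (m + 1)) k (homogeneousSubmodule (Fin 2) k m),
      (∀ i, symPower k m (sl2H k) (b i) = (m - 2 * (i : ℕ) : k) • b i) ∧
      (∀ i : Fin (m + 1), symPower k m (sl2X k) (b i) =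
        (m * (i : ℕ) : k) • b ⟨(i : ℕ) - 1, by omega⟩) ∧
      symPower k m (sl2Y k) (b (Fin.castSucc ⟨0, hm⟩)) = b (Fin.succ ⟨0, hm⟩) := by
  obtain ⟨b, hb⟩ := exists_basis_homogeneousSubmodule k m
  have hmk : (m : k) ≠ 0 := Nat.cast_ne_zero.2 (by omega)
  have hsym : ∀ (a : sl2 k) P, ((symPower k m a P : homogeneousSubmodule (Fin 2) k m) :
      MvPolynomial (Fin 2) k) = symDerivation (a : Matrix (Fin 2) (Fin 2) k) P := fun _ _ => rfl
  have hu : ∀ i : Fin (m + 1), IsUnit ((m : k) ^ (i : ℕ)) := fun i => (pow_ne_zero _ hmk).isUnit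
  have hpow : ∀ (n : ℕ) (Z : MvPolynomial (Fin 2) k),
      (n : MvPolynomial (Fin 2) k) * Z ^ (n - 1) * Z = n * Z ^ n := by
    rintro (_ | n) Z
    · simp
    · simp [pow_succ, mul_assoc]
  refine ⟨b.isUnitSMul hu, fun i => ?_, fun i => ?_, ?_⟩
  · rw [Module.Basis.isUnitSMul_apply, map_smul, smul_comm]
    congr 1
    ext1
    rw [hsym, Submodule.coe_smul, hb, symDerivation_binaryMonomial]
    have hi : (i : ℕ) ≤ m := Nat.lt_succ_iff.1 i.2
    have h0 := hpow (m - i) (X 0)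
    have h1 := hpow i (X 1)
    rw [Nat.cast_sub hi] at h0
    simp only [sl2H, smul_eq_C_mul, of_apply, cons_val', cons_val_zero, cons_val_one,
      cons_val_fin_one, C_0, C_1, C_neg, map_sub, map_mul, map_natCast, map_ofNat,
      Nat.cast_sub hi]
    linear_combination X 1 ^ (i : ℕ) * h0 - X 0 ^ (m - (i : ℕ)) * h1
  · rw [Module.Basis.isUnitSMul_apply, Module.Basis.isUnitSMul_apply, map_smul]
    ext1
    rw [Submodule.coe_smul, Submodule.coe_smul, Submodule.coe_smul, hsym, hb, hb,
      symDerivation_binaryMonomial]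
    rcases Nat.eq_zero_or_pos (i : ℕ) with hi | hi
    · simp [hi, sl2X]
    · have h : m - ((i : ℕ) - 1) = m - (i : ℕ) + 1 := by omega
      have h' : (i : ℕ) = (i : ℕ) - 1 + 1 := by omega
      simp only [h]
      simp only [sl2X, smul_eq_C_mul, of_apply, cons_val', cons_val_zero, cons_val_one,
        cons_val_fin_one, C_0, C_1, map_mul, map_natCast, map_pow]
      have hmi : (m : MvPolynomial (Fin 2) k) ^ (i : ℕ) = m ^ ((i : ℕ) - 1) * m := by
        rw [← pow_succ, ← h']
      rw [hmi]
      ring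
  · rw [Module.Basis.isUnitSMul_apply, Module.Basis.isUnitSMul_apply, map_smul]
    ext1
    rw [Submodule.coe_smul, Submodule.coe_smul, hsym, hb, hb, symDerivation_binaryMonomial]
    simp [sl2Y, smul_eq_C_mul]
    ring

/-- In a representation isomorphic to two copies of `Sym^m`, the vectors `m^i X₀^{m-i} X₁^i` of the
two copies. The factors `m^i` make `y` carry the highest weight vectors to the next basis
vectors. -/
theorem IsTwoCopiesOfSymPower.exists_basis [CharZero k] {V : Type*} [AddCommGroup V] [Module k V]
    {m : ℕ} (hm : 1 ≤ m) {ρ : sl2 k →ₗ⁅k⁆ Module.End k V} (hρ : IsTwoCopiesOfSymPower ρ m) :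
    ∃ f : Module.Basis (Fin (m + 1) ⊕ Fin (m + 1)) k V,
      (∀ α, ρ (sl2H k) (f α) = (m - 2 * coordDegree α : k) • f α) ∧
      (∀ α, ρ (sl2X k) (f α) = (m * coordDegree α : k) • f (coordPred α)) ∧
      ρ (sl2Y k) (f (scrollLo (Sum.inl ⟨0, hm⟩))) = f (scrollHi (Sum.inl ⟨0, hm⟩)) ∧
      ρ (sl2Y k) (f (scrollLo (Sum.inr ⟨0, hm⟩))) = f (scrollHi (Sum.inr ⟨0, hm⟩)) := by
  obtain ⟨e, he⟩ := hρ
  obtain ⟨b, hH, hX, hY⟩ := exists_weight_basis_symPower (k := k) hm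
  have hl : ∀ i, e (((b.prod b).map e.symm) (Sum.inl i)) = (b i, 0) := fun i => by simp
  have hr : ∀ i, e (((b.prod b).map e.symm) (Sum.inr i)) = (0, b i) := fun i => by simp
  refine ⟨(b.prod b).map e.symm, ?_, ?_, ?_, ?_⟩
  · rintro (i | i) <;> apply e.injective
    · rw [he, map_smul, hl, hH]
      simp [coordDegree]
    · rw [he, map_smul, hr, hH]
      simp [coordDegree]
  · rintro (i | i) <;> apply e.injective
    · rw [he, map_smul, hl, hX, coordPred, Sum.map_inl, hl]
      simp [coordDegree]
    · rw [he, map_smul, hr, hX, coordPred, Sum.map_inr, hr]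
      simp [coordDegree]
  · apply e.injective
    rw [he, scrollLo, Sum.map_inl, scrollHi, Sum.map_inl, hl, hl, hY, map_zero]
  · apply e.injective
    rw [he, scrollLo, Sum.map_inr, scrollHi, Sum.map_inr, hr, hr, hY, map_zero]

/-- The eigenvectors of `h` with eigenvalue `m` are the combinations of the two highest weight
vectors of a weight basis. -/
theorem eq_of_highest_weight [CharZero k] {V : Type*} [AddCommGroup V] [Module k V]
    {m : ℕ} (hm : 1 ≤ m) {H : Module.End k V}
    {f : Module.Basis (Fin (m + 1) ⊕ Fin (m + 1)) k V}
    (hf : ∀ α, H (f α) = (m - 2 * coordDegree α : k) • f α) {v : V} (hv : H v = (m : k) • v) :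
    v = f.repr v (Sum.inl 0) • f (scrollLo (Sum.inl ⟨0, hm⟩)) +
      f.repr v (Sum.inr 0) • f (scrollLo (Sum.inr ⟨0, hm⟩)) := by
  have h0 : ∀ α, coordDegree α ≠ 0 → f.repr v α = 0 := by
    intro α hα
    have h1 : H v = ∑ β, (f.repr v β * (m - 2 * coordDegree β : k)) • f β := by
      conv_lhs => rw [← f.sum_repr v, map_sum]
      simp [hf, smul_smul]
    have h2 := congrArg (fun u => f.repr u α) (h1.symm.trans hv)
    rw [f.repr_sum_self, map_smul, Finsupp.smul_apply, smul_eq_mul] at h2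
    have h3 : (coordDegree α : k) * f.repr v α = 0 := by
      linear_combination (-1 / 2 : k) * h2
    exact (mul_eq_zero.1 h3).resolve_left (Nat.cast_ne_zero.2 hα)
  conv_lhs => rw [← f.sum_repr v, Fintype.sum_sum_type]
  congr 1
  · exact Finset.sum_eq_single_of_mem 0 (Finset.mem_univ _) fun i _ hi => by
      rw [h0 _ (by simpa [coordDegree] using hi), zero_smul]
  · exact Finset.sum_eq_single_of_mem 0 (Finset.mem_univ _) fun i _ hi => by
      rw [h0 _ (by simpa [coordDegree] using hi), zero_smul]

end SymPower

/-! ### The lines of the scroll -/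

section Lines

variable {k : Type*} [Field k] {m : ℕ}

theorem ruling_eq_ruling_of_mul_eq_mul {c c' : Fin 2 → k} (hc : c ≠ 0) (hc' : c' ≠ 0)
    (h : c 0 * c' 1 = c 1 * c' 0) : ruling m c = ruling m c' := by
  rw [← ruling_rep_mk hc, mk_eq_mk_of_mul_eq_mul hc hc' h, ruling_rep_mk hc']

/-- For `m ≥ 2` two vectors of the cone whose sum lies in the cone belong to one plane of the
ruling. Otherwise they lie in the planes of two parameters `c` and `c'`, and `x + x'` in that of
`c''`. The defect of the equations of `c''` at `x` is the negative of the defect at `x'`. As a vector of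
the smaller space of `S_{m-1,m-1}`, it satisfies the equations of both `c` and `c'`, so it is zero. -/
theorem mem_ruling_of_add_mem_scrollCone (hm : 2 ≤ m) {c : Fin 2 → k} (hc : c ≠ 0)
    {x x' : Fin (m + 1) ⊕ Fin (m + 1) → k} (hx0 : x ≠ 0) (hx : x ∈ ruling m c)
    (hx' : x' ∈ scrollCone k m) (hadd : x + x' ∈ scrollCone k m) : x' ∈ ruling m c := by
  obtain ⟨c', hc', hx'⟩ := hx'
  obtain ⟨c'', hc'', hadd⟩ := hadd
  by_cases hcc : c 0 * c' 1 = c 1 * c' 0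
  · rwa [ruling_eq_ruling_of_mul_eq_mul hc hc' hcc]
  obtain ⟨n, rfl⟩ : ∃ n, m = n + 1 := ⟨m - 1, by omega⟩
  let r : Fin (n + 1) ⊕ Fin (n + 1) → k := fun j => c'' 1 * x (scrollLo j) - c'' 0 * x (scrollHi j)
  have hswap : ∀ i : Fin n ⊕ Fin n, scrollLo (scrollHi i) = scrollHi (scrollLo i) := by
    rintro (i | i) <;> rfl
  have hr' : ∀ j, r j = -(c'' 1 * x' (scrollLo j) - c'' 0 * x' (scrollHi j)) := by
    intro j
    have h := hadd j
    simp only [Pi.add_apply] at h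
    simp only [r]
    linear_combination h
  have hr : r ∈ ruling n c := by
    intro i
    have h1 := hx (scrollLo i)
    have h2 := hx (scrollHi i)
    rw [hswap] at h2
    simp only [r, hswap]
    linear_combination c'' 1 * h1 - c'' 0 * h2
  have hr2 : r ∈ ruling n c' := by
    intro i
    have h1 := hx' (scrollLo i)
    have h2 := hx' (scrollHi i)
    rw [hswap] at h2
    simp only [hr', hswap]
    linear_combination c'' 0 * h2 - c'' 1 * h1
  have hr0 : r = 0 := by
    by_contra h0
    exact hcc (mul_eq_mul_of_mem_ruling (by omega) h0 hr hr2)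
  have hxc : x ∈ ruling (n + 1) c'' := fun j => sub_eq_zero.1 (congrFun hr0 j)
  rw [ruling_eq_ruling_of_mul_eq_mul hc hc''
    (mul_eq_mul_of_mem_ruling (by omega) hx0 hx hxc)]
  simpa using Submodule.sub_mem _ hadd hxc

/-- For `m ≥ 2` the only planes contained in the cone are those of the ruling. -/
theorem exists_eq_ruling (hm : 2 ≤ m) {U : Submodule k (Fin (m + 1) ⊕ Fin (m + 1) → k)}
    (hU : Module.finrank k U = 2) (h : ∀ x ∈ U, x ∈ scrollCone k m) :
    ∃ c : Fin 2 → k, c ≠ 0 ∧ U = ruling m c := by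
  obtain ⟨x, hxU, hx0⟩ := U.exists_mem_ne_zero_of_ne_bot (by rintro rfl; simp at hU)
  obtain ⟨c, hc, hx⟩ := h x hxU
  refine ⟨c, hc, Submodule.eq_of_le_of_finrank_eq (fun x' hx' => ?_)
    (hU.trans (finrank_ruling hc).symm)⟩
  exact mem_ruling_of_add_mem_scrollCone hm hc hx0 hx (h x' hx') (h _ (U.add_mem hxU hx'))

end Lines

/-! ### The morphism to the projective line -/

section Fibration

variable {k : Type*} [Field k] {ι : Type*} {m : ℕ} {X : Set (ℙ k (ι → k))}
  {y : (ι → k) ≃ₗ[k] (Fin (m + 1) ⊕ Fin (m + 1) → k)}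

theorem rep_mem_scrollCone (hX : coneOf X = y ⁻¹' scrollCone k m) {p : ℙ k (ι → k)}
    (hp : p ∈ X) : y p.rep ∈ scrollCone k m := by
  rw [← Set.mem_preimage, ← hX]
  intro h
  rwa [Projectivization.mk_rep]

theorem mem_of_rep_mem_scrollCone (hX : coneOf X = y ⁻¹' scrollCone k m) {p : ℙ k (ι → k)}
    (hp : y p.rep ∈ scrollCone k m) : p ∈ X := by
  rw [← Set.mem_preimage, ← hX] at hp
  simpa using hp p.rep_nonzero

/-- The map that sends a point of `X` to the parameter of the line of the ruling that contains
it. -/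
def rulingMap (hX : coneOf X = y ⁻¹' scrollCone k m) (p : X) : ℙ k (Fin 2 → k) :=
  Projectivization.mk k (rep_mem_scrollCone hX p.2).choose
    (rep_mem_scrollCone hX p.2).choose_spec.1

theorem rulingMap_eq_mk_iff (hm : 1 ≤ m) (hX : coneOf X = y ⁻¹' scrollCone k m) {p : X}
    {c : Fin 2 → k} (hc : c ≠ 0) :
    rulingMap hX p = Projectivization.mk k c hc ↔ y p.1.rep ∈ ruling m c := by
  have hspec := (rep_mem_scrollCone hX p.2).choose_spec
  constructor
  · intro h
    rw [← ruling_rep_mk hc, ← h, rulingMap, ruling_rep_mk]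
    exact hspec.2
  · intro h
    refine mk_eq_mk_of_mul_eq_mul _ _ (mul_eq_mul_of_mem_ruling hm ?_ hspec.2 h)
    exact (map_ne_zero_iff y y.injective).2 p.1.rep_nonzero

/-- The parameter of the line through `p` is `(a : b)` for any two numbers, not both zero, that are
in the same ratio as the rows of the matrix of `p`. -/
theorem rulingMap_eq_mk_of_ratio (hX : coneOf X = y ⁻¹' scrollCone k m) {p : X} {a b : k}
    (hab : ![a, b] ≠ 0) (h : ∀ c : Fin 2 → k, y p.1.rep ∈ ruling m c → c 1 * a = c 0 * b) :
    rulingMap hX p = Projectivization.mk k ![a, b] hab :=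
  mk_eq_mk_of_mul_eq_mul _ _
    (by simpa using (h _ (rep_mem_scrollCone hX p.2).choose_spec.2).symm)

theorem fibre_rulingMap (hm : 1 ≤ m) (hX : coneOf X = y ⁻¹' scrollCone k m)
    (c : ℙ k (Fin 2 → k)) :
    fibre (rulingMap hX) c = {p | p.submodule ≤ (ruling m c.rep).map y.symm.toLinearMap} := by
  ext p
  have h1 : p.submodule ≤ (ruling m c.rep).map y.symm.toLinearMap ↔ y p.rep ∈ ruling m c.rep := by
    rw [Projectivization.submodule_eq, Submodule.span_singleton_le_iff_mem,
      Submodule.mem_map_equiv, LinearEquiv.symm_symm]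
  have h2 : ∀ q : X, rulingMap hX q = c ↔ y q.1.rep ∈ ruling m c.rep := fun q => by
    rw [← rulingMap_eq_mk_iff hm hX c.rep_nonzero, Projectivization.mk_rep]
  rw [Set.mem_ofPred_eq, h1]
  constructor
  · rintro ⟨q, hq, rfl⟩
    exact (h2 q).1 hq
  · intro h
    exact ⟨⟨p, mem_of_rep_mem_scrollCone hX ⟨_, c.rep_nonzero, h⟩⟩, (h2 _).2 h, rfl⟩

theorem isLine_fibre_rulingMap (hm : 1 ≤ m) (hX : coneOf X = y ⁻¹' scrollCone k m)
    (c : ℙ k (Fin 2 → k)) : IsLine (fibre (rulingMap hX) c) :=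
  ⟨_, (LinearEquiv.finrank_map_eq y.symm _).trans (finrank_ruling c.rep_nonzero),
    fibre_rulingMap hm hX c⟩

theorem exists_eq_fibre_rulingMap (hm : 2 ≤ m) (hX : coneOf X = y ⁻¹' scrollCone k m)
    {l : Set (ℙ k (ι → k))} (hl : IsLine l) (hlX : l ⊆ X) : ∃ c, l = fibre (rulingMap hX) c := by
  obtain ⟨W, hW, rfl⟩ := hl
  have hWX : ∀ x ∈ W.map y.toLinearMap, x ∈ scrollCone k m := by
    rintro _ ⟨x, hx, rfl⟩
    have : x ∈ coneOf X := fun h => hlX (by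
      rw [Set.mem_ofPred_eq, Projectivization.submodule_mk]
      exact (Submodule.span_singleton_le_iff_mem _ _).2 hx)
    rwa [hX] at this
  obtain ⟨c, hc, h⟩ := exists_eq_ruling hm ((LinearEquiv.finrank_map_eq y W).trans hW) hWX
  refine ⟨Projectivization.mk k c hc, ?_⟩
  have hWc : (ruling m c).map y.symm.toLinearMap = W := by
    rw [← h]
    ext x
    simp
  rw [fibre_rulingMap (by omega), ruling_rep_mk, hWc]

variable [Fintype ι]

/-- Near a point where the `j`-th column of the `2 × 2m` matrix is not zero, the map is given by
that column. -/
theorem isMorphism_rulingMap (hm : 1 ≤ m) (hX : coneOf X = y ⁻¹' scrollCone k m) :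
    IsMorphism (rulingMap hX) := by
  classical
  intro p
  let F : Fin m ⊕ Fin m → Fin 2 → MvPolynomial ι k := fun j =>
    ![linPoly (LinearMap.proj (scrollLo j) ∘ₗ y.toLinearMap),
      linPoly (LinearMap.proj (scrollHi j) ∘ₗ y.toLinearMap)]
  have hF : ∀ j (x : ι → k), (fun i => eval x (F j i)) = ![y x (scrollLo j), y x (scrollHi j)] := by
    intro j x
    ext i
    fin_cases i <;> simp [F, eval_linPoly]
  obtain ⟨j, hj⟩ := exists_scrollLo_or_scrollHi_ne_zero hm
    ((map_ne_zero_iff y y.injective).2 p.1.rep_nonzero)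
  refine ⟨1, F j, fun i => ?_, ?_, fun q hq => ?_⟩
  · fin_cases i <;> exact isHomogeneous_linPoly _
  · rw [hF]
    exact fun h => hj.elim (fun h0 => h0 (congrFun h 0)) (fun h1 => h1 (congrFun h 1))
  · simp only [hF] at hq ⊢
    exact rulingMap_eq_mk_of_ratio hX hq fun c hc => hc j

/-- A linear form that is not zero does not vanish on a dense subset of `X`. -/
theorem subset_zariskiClosure_ne_zero [Infinite k] (hX : coneOf X = y ⁻¹' scrollCone k m)
    {v : ι → k} (hv : v ≠ 0) : X ⊆ zariskiClosure {p ∈ X | v ⬝ᵥ p.rep ≠ 0} := by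
  classical
  intro p hp d F hF h
  let l : (ι → k) →ₗ[k] k := dotProductBilin k k v
  have hl : ∀ x, l x = v ⬝ᵥ x := fun x => rfl
  let Q := linPoly (l ∘ₗ y.symm.toLinearMap)
  have hQ : ∀ z, eval z Q = v ⬝ᵥ y.symm z := fun z => eval_linPoly _ _
  let P : MvPolynomial (Fin (m + 1) ⊕ Fin (m + 1)) k :=
    bind₁ (fun i => linPoly (LinearMap.proj i ∘ₗ y.symm.toLinearMap)) F
  have hP : ∀ z, eval z P = eval (y.symm z) F := by
    intro z
    rw [← coe_aeval_eq_eval, RingHom.coe_coe, aeval_bind₁, ← coe_aeval_eq_eval, RingHom.coe_coe]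
    congr 2
    ext i
    exact eval_linPoly _ _
  have hPQ : ∀ z ∈ scrollCone k m, eval z Q ≠ 0 → eval z P = 0 := by
    intro z hz hzQ
    rw [hQ] at hzQ
    have hz0 : y.symm z ≠ 0 := fun h0 => hzQ (by rw [h0, dotProduct_zero])
    have hzX : y.symm z ∈ coneOf X := by rw [hX]; simpa using hz
    rw [hP, ← eval_rep_mk_eq_zero_iff hF hz0]
    refine h _ ⟨hzX hz0, ?_⟩
    rwa [← hl, ← eval_linPoly, Ne, eval_rep_mk_eq_zero_iff (isHomogeneous_linPoly l), eval_linPoly]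
  have hne : ∃ z ∈ scrollCone k m, eval z Q ≠ 0 := by
    by_contra! h0
    have hl0 : l ∘ₗ y.symm.toLinearMap = 0 :=
      eq_zero_of_forall_scrollCone fun z hz => by rw [← eval_linPoly]; exact h0 z hz
    refine hv (dotProduct_eq_zero v fun x => ?_)
    have := congrArg (fun f => f (y x)) hl0
    simpa [hl] using this
  have := eval_eq_zero_of_mem_scrollCone hPQ hne (rep_mem_scrollCone hX hp)
  rwa [hP, LinearEquiv.symm_apply_apply] at this

/-- If `v = a x_{0,0} + b x_{1,0}` and `w = a x_{0,1} + b x_{1,1}`, then `w / v` is the parameter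
of the ruling. -/
theorem isDefinedByQuotient_rulingMap [Infinite k] (hm : 1 ≤ m)
    (hX : coneOf X = y ⁻¹' scrollCone k m) {v w : ι → k} (hv0 : v ≠ 0) {a b : k}
    {i j : Fin m ⊕ Fin m}
    (hv : ∀ x, v ⬝ᵥ x = a * y x (scrollLo i) + b * y x (scrollLo j))
    (hw : ∀ x, w ⬝ᵥ x = a * y x (scrollHi i) + b * y x (scrollHi j)) :
    IsDefinedByQuotient (rulingMap hX) w v := by
  refine ⟨isMorphism_rulingMap hm hX, subset_zariskiClosure_ne_zero hX hv0, fun p hp => ?_⟩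
  refine rulingMap_eq_mk_of_ratio hX hp fun c hc => ?_
  rw [hv, hw]
  linear_combination a * hc i + b * hc j

end Fibration

/-- A weight basis for the given copy of `sl₂` gives coordinates in which `X` is the scroll. -/
theorem coneOf_eq_preimage_of_weight_basis {k : Type*} [Field k] [IsAlgClosed k] [CharZero k]
    {m : ℕ} (hm : 1 ≤ m) {ι : Type*} [Fintype ι] [DecidableEq ι] {X : Set (ℙ k (ι → k))}
    {S : LieSubalgebra k (lieAlgebraOf X)} {I : LieIdeal k S} (σ : sl2 k ≃ₗ⁅k⁆ I)
    {g y : (ι → k) ≃ₗ[k] (Fin (m + 1) ⊕ Fin (m + 1) → k)}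
    (hg : coneOf X = g ⁻¹' scrollCone k m) {f : Fin (m + 1) ⊕ Fin (m + 1) → ι → k}
    (hy : ∀ x α, y x α = f α ⬝ᵥ x)
    (hH : ∀ α, summandRep σ (sl2H k) (f α) = (m - 2 * coordDegree α : k) • f α)
    (hE : ∀ α, summandRep σ (sl2X k) (f α) = (m * coordDegree α : k) • f (coordPred α)) :
    coneOf X = y ⁻¹' scrollCone k m := by
  have hmk : (m : k) ≠ 0 := Nat.cast_ne_zero.2 (by omega)
  -- The matrices act on linear forms by the negative transpose, hence the signs in `hyH`, `hyE`.
  let M : sl2 k → Matrix ι ι k := fun a => (σ a : S).1.1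
  have hM : ∀ a, IsTangentAtOne (projStabilizer X) (M a) := fun a => (σ a : S).1.2.2
  have hrep : ∀ (a : sl2 k) (u x : ι → k), u ⬝ᵥ (M a *ᵥ x) = -(summandRep σ a u ⬝ᵥ x) := by
    intro a u x
    have : summandRep σ a u = -((M a)ᵀ *ᵥ u) := rfl
    rw [this, neg_dotProduct, neg_neg, dotProduct_mulVec, mulVec_transpose]
  have hyH : ∀ x, y (M (sl2H k) *ᵥ x) =
      ((2 : k) • degreeOp k m - (m : k) • LinearMap.id : Module.End k _) (y x) := by
    intro x
    ext α
    rw [hy, hrep, hH, smul_dotProduct, ← hy]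
    simp only [LinearMap.sub_apply, LinearMap.smul_apply, LinearMap.id_apply, Pi.sub_apply,
      Pi.smul_apply, degreeOp_apply, smul_eq_mul]
    ring
  have hyE : ∀ x, y (M (sl2X k) *ᵥ x) = (-(m : k) • lowerOp k m : Module.End k _) (y x) := by
    intro x
    ext α
    rw [hy, hrep, hE, smul_dotProduct, ← hy]
    simp only [LinearMap.smul_apply, Pi.smul_apply, lowerOp_apply, smul_eq_mul]
    ring
  have hiff := mem_scrollCone_iff_of_stable (y.symm.trans g) ?_ ?_
  · ext x
    rw [hg, Set.mem_preimage, Set.mem_preimage, ← hiff (y x)]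
    simp
  · intro B hB z hz
    have h := (hM (sl2H k)).bilinDerivation_mem_of_intertwines hg hyH hB z hz
    have h' := hB z hz
    simp only [bilinDerivation_apply, LinearMap.sub_apply, LinearMap.smul_apply, map_sub, map_smul,
      LinearMap.id_apply, h', smul_eq_mul] at h ⊢
    linear_combination (1 / 2 : k) * h
  · intro B hB z hz
    have h := (hM (sl2X k)).bilinDerivation_mem_of_intertwines hg hyE hB z hz
    simp only [bilinDerivation_apply, LinearMap.smul_apply, map_smul, smul_eq_mul] at h ⊢
    rw [← mul_add] at h
    exact (mul_eq_zero.1 h).resolve_left (neg_ne_zero.2 hmk)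

end LineFibration

end

open LineFibration in
theorem mainTheorem3 {k : Type*} [Field k] [IsAlgClosed k] [CharZero k] (m : ℕ) (hm : 1 ≤ m)
    (X : Set (ℙ k (Fin (2 * m + 2) → k)))
    (hX : ProjectivelyIsomorphic X (scroll k m m))
    (S : LieSubalgebra k (lieAlgebraOf X)) (hS : IsLeviSubalgebra S)
    (I : LieIdeal k S) (σ : sl2 k ≃ₗ⁅k⁆ I)
    (hσ : IsTwoCopiesOfSymPower (summandRep σ) m)
    (v w : Fin (2 * m + 2) → k)
    (hv : (summandRep σ (sl2H k)).HasEigenvector (m : k) v)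
    (hw : w = summandRep σ (sl2Y k) v) :
    ∃ φ : X → ℙ k (Fin 2 → k), IsDefinedByQuotient φ w v ∧
      (∀ c, IsLine (fibre φ c)) ∧
      (2 ≤ m → ∀ l : Set (ℙ k (Fin (2 * m + 2) → k)), IsLine l → l ⊆ X → ∃ c, l = fibre φ c) := by
  have : Infinite k := IsAlgClosed.instInfinite
  obtain ⟨g, hg⟩ := hX
  obtain ⟨f, hH, hE, hY0, hY1⟩ := hσ.exists_basis hm
  obtain ⟨y, hy⟩ := exists_coordinates f
  have hXy := coneOf_eq_preimage_of_weight_basis hm σ (coneOf_eq_preimage hg) hy hH hE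
  have hv' := eq_of_highest_weight hm hH hv.apply_eq_smul
  have hw' := congrArg (summandRep σ (sl2Y k)) hv'
  rw [← hw, map_add, map_smul, map_smul, hY0, hY1] at hw'
  refine ⟨rulingMap hXy, ?_, isLine_fibre_rulingMap hm hXy,
    fun h2 l hl hlX => exists_eq_fibre_rulingMap h2 hXy hl hlX⟩
  refine isDefinedByQuotient_rulingMap hm hXy hv.2 (a := f.repr v (Sum.inl 0))
    (b := f.repr v (Sum.inr 0)) (i := Sum.inl ⟨0, hm⟩) (j := Sum.inr ⟨0, hm⟩)
    (fun x => ?_) (fun x => ?_)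
  · conv_lhs => rw [hv']
    rw [add_dotProduct, smul_dotProduct, smul_dotProduct, ← hy, ← hy, smul_eq_mul, smul_eq_mul]
  · rw [hw', add_dotProduct, smul_dotProduct, smul_dotProduct, ← hy, ← hy, smul_eq_mul,
      smul_eq_mul]
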